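/- **Setting.** Fix an exponential family on $\mathbb{R}$ with densities $f(y;\vartheta)=\exp\{(y\vartheta-\psi(\vartheta))/a(\phi)+c(y,\phi)\}$ with respect to a reference measure, where $a(\phi)>0$ and $\psi$ is the cumulant function on the natural parameter space $\Theta\subseteq\mathbb{R}$. Let $d\ge 1$, $n\le N$, let $\mathbf{x}_1,\dots,\mathbf{x}_N$ be random vectors in $\mathbb{R}^d$ with latent responses $y_1^*,\dots,y_N^*$ such that $y_j^*\mid \mathbf{x}_j$ has density $f(\cdot\,;\mathbf{x}_j^\top\beta^*)$ (canonical link) for some $\beta^*\in\mathbb{R}^d$. One observes $(\mathbf{x}_i,y_i)$, $1\le i\le n$, where $y_i=y^*_{\pi^*(i)}$ for a map $\pi^*:\{1,\dots,n\}\to\{1,\dots,N\}$; $k=|\{i:\pi^*(i)\ne i\}|$ is the number of mismatches. For $\theta=(\beta,\xi)\in\mathbb{R}^{d+n}$ put $$\ell(\theta)=\frac1n\sum_{i=1}^n\left\{-y_i(\mathbf{x}_i^\top\beta+\sqrt n\,\xi_i)+\psi(\mathbf{x}_i^\top\beta+\sqrt n\,\xi_i)\right\},\qquad \ell_{\rm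 pen}(\theta)=\ell(\theta)+\lambda\|\xi\|_1$$ (with $\psi=+\infty$ outside $\Theta$), and $\theta^*=(\beta^*,\xi^*)$ with $\xi^*_i=n^{-1/2}(\mathbf{x}_{\pi^*(i)}-\mathbf{x}_i)^\top\beta^*$. **Assumptions.** (A) $\mathbf{x}_1,\dots,\mathbf{x}_n$ are i.i.d. copies of a random vector $\mathbf{x}$ with $\|\mathbf{x}\|_2\le r$ almost surely for some $r>0$; its second moment matrix $\Sigma=\mathbb{E}[\mathbf{x}\mathbf{x}^\top]$ satisfies $\sigma_{\min}I_d\preceq\Sigma\preceq\sigma_{\max}I_d$ with $0<\sigma_{\min}\le 4$; and $\langle v,\Sigma^{-1/2}\mathbf{x}\rangle$ has sub-Gaussian norm at most $K$ for all unit vectors $v$. (C1) $\nu_n>0$ and $\|\nabla\ell(\theta^*)\|_\infty\le\nu_n$ with probability at least $1-\epsilon_n$. (C2) $R>0$, $0<\lambda_R\le\Lambda_R<\infty$, and with probability at least $1-\epsilon_n'$ one has, for all $i$ and all $u$ with $\|u\|_2\le R$, that $z=\mathbf{x}_i^\top\beta+\sqrt n\,\xi_i$ with $(\beta,\xi)=\theta^*+u$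 is an interior point of $\Theta$ with $\lambda_R\le\psi''(z)\le\Lambda_R$, and $\frac{32}{\sigma_{\min}\lambda_R}(\lambda+\nu_n)\sqrt{d+k}\le R$. **Theorem.** For all $K>0$ and $c\in(0,1)$ there is a constant $C_0>0$, depending only on $K$ and $c$, such that the following holds. Suppose (A), (C1), (C2), $2\nu_n\le\lambda\le C\nu_n$ for some $C>0$, $d+k\le cn$, and $$n\ \ge\ C'\,\frac{\sigma_{\max}}{\sigma_{\min}}\left(\frac{\Lambda_R}{\lambda_R}\right)^2\left\{(d+k)\log\left(\frac{n}{d+k}\right)\vee\log n\right\},\qquad C'=\frac{C_0}{\sigma_{\min}}.$$ Then, with probability at least $1-\epsilon_n-\epsilon_n'-2/n$, every minimizer $\widehat\theta$ of $\ell_{\rm pen}$ satisfies $$\|\widehat\theta-\theta^*\|_2\le\frac{32}{\sigma_{\min}\lambda_R}(\lambda+\nu_n)\sqrt{d+k}.$$ -/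

import Mathlib

open MeasureTheory ProbabilityTheory
open scoped ENNReal NNReal

noncomputable section

/-! ### Exponential families -/

/-- Natural parameter space of the exponential family with reference measure `ref`, scale `a` and
partition function `c`: the set of `ϑ` with `∫ exp (y ϑ / a + c y) d ref(y) < ∞`. -/
def naturalParameterSpace (ref : Measure ℝ) (a : ℝ) (c : ℝ → ℝ) : Set ℝ :=
  {ϑ | ∫⁻ y, ENNReal.ofReal (Real.exp (y * ϑ / a + c y)) ∂ref < ∞}

/-- An exponential family with a fixed value of the scale parameter `φ`, so that `a` stands for
`a(φ)` and `c y` for `c(y, φ)`. The densities are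
`f(y; ϑ) = exp ((y ϑ - ψ ϑ) / a + c y)` with respect to the reference measure `ref`
(e.g. Lebesgue measure, or a counting measure, on the support). The normalization forces `ψ` to be
the cumulant function on the natural parameter space; its values elsewhere are never used. -/
structure ExpFamily where
  /-- reference measure -/
  ref : Measure ℝ
  /-- value of the scale function -/
  a : ℝ
  a_pos : 0 < a
  /-- cumulant function -/
  ψ : ℝ → ℝ
  /-- partition function -/
  c : ℝ → ℝ
  measurable_c : Measurable c
  normalized : ∀ ϑ ∈ naturalParameterSpace ref a c,
    ∫⁻ y, ENNReal.ofReal (Real.exp ((y * ϑ - ψ ϑ) / a + c y)) ∂ref = 1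

namespace ExpFamily

/-- The natural parameter space of the family. -/
def Θ (F : ExpFamily) : Set ℝ := naturalParameterSpace F.ref F.a F.c

/-- The density `f(y; ϑ)`. -/
def density (F : ExpFamily) (ϑ y : ℝ) : ℝ := Real.exp ((y * ϑ - F.ψ ϑ) / F.a + F.c y)

/-- The member of the family with natural parameter `ϑ`, as a measure. -/
def law (F : ExpFamily) (ϑ : ℝ) : Measure ℝ :=
  F.ref.withDensity fun y => ENNReal.ofReal (F.density ϑ y)

end ExpFamily

/-! ### The mismatch model -/

/-- A register of `N` covariate vectors `x j` with latent responses `ystar j`; conditionally on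
`x j`, the response `ystar j` follows the GLM with canonical link and regression parameter `β`.
The `i`-th record of the merged file consists of the covariate `x i` and of the response
`ystar (perm i)`. -/
structure LinkedGLM (F : ExpFamily) {Ω : Type*} [MeasurableSpace Ω] (P : Measure Ω)
    [IsProbabilityMeasure P] (d n N : ℕ) where
  le : n ≤ N
  /-- covariates in the register -/
  x : Fin N → Ω → EuclideanSpace ℝ (Fin d)
  /-- latent responses -/
  ystar : Fin N → Ω → ℝ
  /-- the regression parameter -/
  β : EuclideanSpace ℝ (Fin d)
  /-- the map that sends `i` to the index of the covariate that truly belongs to response `i` -/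
  perm : Fin n → Fin N
  measurable_x : ∀ j, Measurable (x j)
  measurable_ystar : ∀ j, Measurable (ystar j)
  glm : ∀ j, ∀ᵐ ω ∂P, inner ℝ (x j ω) β ∈ F.Θ ∧
    condDistrib (ystar j) (x j) P (x j ω) = F.law (inner ℝ (x j ω) β)

/-- The parameter space `ℝ^(d+n)` with its Euclidean norm; `θ (Sum.inl a)` are the entries of `β`
and `θ (Sum.inr i)` those of `ξ`. -/
abbrev Param (d n : ℕ) : Type := EuclideanSpace ℝ (Fin d ⊕ Fin n)

namespace LinkedGLM

variable {F : ExpFamily} {Ω : Type*} [MeasurableSpace Ω] {P : Measure Ω} [IsProbabilityMeasure P]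
  {d n N : ℕ}

/-- The rows of the design matrix of the merged file. -/
def row (M : LinkedGLM F P d n N) (i : Fin n) (ω : Ω) : EuclideanSpace ℝ (Fin d) :=
  M.x (Fin.castLE M.le i) ω

/-- The responses in the merged file. -/
def resp (M : LinkedGLM F P d n N) (ω : Ω) (i : Fin n) : ℝ := M.ystar (M.perm i) ω

/-- The number `k` of mismatches. -/
def mismatches (M : LinkedGLM F P d n N) : ℕ :=
  (Finset.univ.filter fun i : Fin n => M.perm i ≠ Fin.castLE M.le i).card

/-- The target `θ* = [β*; ξ*]`, `ξ*_i = n^(-1/2) (x_{π*(i)} - x_i)ᵀ β*`. -/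
def thetaStar (M : LinkedGLM F P d n N) (ω : Ω) : Param d n :=
  WithLp.toLp 2 (Sum.elim (fun a => M.β a)
    (fun i => 1 / Real.sqrt n * inner ℝ (M.x (M.perm i) ω - M.row i ω) M.β))

end LinkedGLM

/-! ### The penalized negative log-likelihood -/

section Likelihood

variable {d n : ℕ}

/-- The augmented linear predictor `x_iᵀ β + √n ξ_i`. -/
def linPred (X : Fin n → EuclideanSpace ℝ (Fin d)) (θ : Param d n) (i : Fin n) : ℝ :=
  (∑ a, X i a * θ (Sum.inl a)) + Real.sqrt n * θ (Sum.inr i)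

/-- The negative log-likelihood
`ℓ(θ) = (1/n) (-⟨Xβ + √n ξ, y⟩ + ∑ i, ψ (x_iᵀ β + √n ξ_i))`. -/
def negLogLik (ψ : ℝ → ℝ) (X : Fin n → EuclideanSpace ℝ (Fin d)) (y : Fin n → ℝ)
    (θ : Param d n) : ℝ :=
  1 / (n : ℝ) * (-(∑ i, linPred X θ i * y i) + ∑ i, ψ (linPred X θ i))

/-- `ℓ_pen(θ) = ℓ(θ) + λ ‖ξ‖₁`. -/
def penNegLogLik (ψ : ℝ → ℝ) (X : Fin n → EuclideanSpace ℝ (Fin d)) (y : Fin n → ℝ)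
    (lam : ℝ) (θ : Param d n) : ℝ :=
  negLogLik ψ X y θ + lam * ∑ i : Fin n, |θ (Sum.inr i)|

/-- The parameters for which all linear predictors lie in the natural parameter space
(everything, if the latter is the real line); the negative log-likelihood is infinite elsewhere. -/
def feasible (F : ExpFamily) (X : Fin n → EuclideanSpace ℝ (Fin d)) : Set (Param d n) :=
  {θ | ∀ i, linPred X θ i ∈ F.Θ}

/-- `θ` is a (global) minimizer of the penalized negative log-likelihood. -/
def IsPenMinimizer (F : ExpFamily) (X : Fin n → EuclideanSpace ℝ (Fin d)) (y : Fin n → ℝ)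
    (lam : ℝ) (θ : Param d n) : Prop :=
  θ ∈ feasible F X ∧ IsMinOn (penNegLogLik F.ψ X y lam) (feasible F X) θ

end Likelihood

/-! ### Assumptions and conditions -/

/-- The sub-Gaussian norm `inf {t > 0 : E exp (Z² / t²) ≤ 2}` of a random variable `Z`, with value
`∞` if `Z` is not sub-Gaussian. -/
def subGaussianNorm {E : Type*} [MeasurableSpace E] (μ : Measure E) (Z : E → ℝ) : ℝ≥0∞ :=
  ⨅ (t : ℝ≥0) (_ : 0 < t) (_ : ∫⁻ x, ENNReal.ofReal (Real.exp (Z x ^ 2 / (t : ℝ) ^ 2)) ∂μ ≤ 2),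
    (t : ℝ≥0∞)

/-- The second moment matrix `E[x xᵀ]` of a random vector with law `ρ`. -/
def secondMoment {d : ℕ} (ρ : Measure (EuclideanSpace ℝ (Fin d))) : Matrix (Fin d) (Fin d) ℝ :=
  Matrix.of fun a b => ∫ x, x a * x b ∂ρ

section InvSqrt

open scoped MatrixOrder Matrix.Norms.L2Operator

/-- `S^(-1/2)` for a positive definite matrix `S`. -/
def invSqrt {d : ℕ} (S : Matrix (Fin d) (Fin d) ℝ) : Matrix (Fin d) (Fin d) ℝ :=
  (CFC.sqrt S)⁻¹

end InvSqrt

/-- Assumption (A): the rows are i.i.d. copies of a random vector `x`, with law `ρ`, such that,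
with `Σ = E[x xᵀ]`, one has `σmin I ≤ Σ ≤ σmax I`, the variables `⟨v, Σ^(-1/2) x⟩` have
sub-Gaussian norm at most `K` for all unit vectors `v`, and `x` is bounded. -/
structure AssumptionA {Ω : Type*} [MeasurableSpace Ω] (P : Measure Ω) {d n : ℕ}
    (X : Fin n → Ω → EuclideanSpace ℝ (Fin d)) (ρ : Measure (EuclideanSpace ℝ (Fin d)))
    (K σmin σmax : ℝ) : Prop where
  indep : iIndepFun X P
  law : ∀ i, P.map (X i) = ρ
  lower : (secondMoment ρ - σmin • (1 : Matrix (Fin d) (Fin d) ℝ)).PosSemidef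
  upper : (σmax • (1 : Matrix (Fin d) (Fin d) ℝ) - secondMoment ρ).PosSemidef
  subGaussian : ∀ v : EuclideanSpace ℝ (Fin d), ‖v‖ = 1 →
    subGaussianNorm ρ (fun x => inner ℝ v ((invSqrt (secondMoment ρ)).toEuclideanLin x))
      ≤ ENNReal.ofReal K
  bounded : ∃ r : ℝ, 0 < r ∧ ∀ᵐ x ∂ρ, ‖x‖ ≤ r

/-- The property `Q` holds on a measurable event of probability at least `p`. -/
def HoldsWithProb {Ω : Type*} [MeasurableSpace Ω] (P : Measure Ω) (p : ℝ) (Q : Ω → Prop) : Prop :=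
  ∃ E : Set Ω, MeasurableSet E ∧ p ≤ P.real E ∧ ∀ ω ∈ E, Q ω

section Conditions

variable {F : ExpFamily} {Ω : Type*} [MeasurableSpace Ω] {P : Measure Ω} [IsProbabilityMeasure P]
  {d n N : ℕ}

/-- Condition (C1): `‖∇ ℓ(θ*)‖_∞ ≤ ν` with probability at least `1 - ε`. -/
def ConditionC1 (M : LinkedGLM F P d n N) (ν ε : ℝ) : Prop :=
  HoldsWithProb P (1 - ε) fun ω =>
    DifferentiableAt ℝ (negLogLik F.ψ (fun i => M.row i ω) (M.resp ω)) (M.thetaStar ω) ∧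
    ∀ s, |gradient (negLogLik F.ψ (fun i => M.row i ω) (M.resp ω)) (M.thetaStar ω) s| ≤ ν

/-- The quantity `32 (λ + ν) √(d + k) / (σmin λ_R)`. -/
def errorBound (M : LinkedGLM F P d n N) (σmin lamR lam ν : ℝ) : ℝ :=
  32 / (σmin * lamR) * (lam + ν) * Real.sqrt ((d : ℝ) + M.mismatches)

/-- Condition (C2): with probability at least `1 - ε'`, all linear predictors attached to parameters
in the ball of radius `R` around `θ*` are interior points of the natural parameter space at which
`lamR ≤ ψ'' ≤ LamR`, and `R` is at least the error bound. -/
def ConditionC2 (M : LinkedGLM F P d n N) (R lamR LamR σmin lam ν ε' : ℝ) : Prop :=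
  HoldsWithProb P (1 - ε') fun ω =>
    (∀ i, ∀ u : Param d n, ‖u‖ ≤ R →
      linPred (fun i => M.row i ω) (M.thetaStar ω + u) i ∈ interior F.Θ ∧
      lamR ≤ deriv (deriv F.ψ) (linPred (fun i => M.row i ω) (M.thetaStar ω + u) i) ∧
      deriv (deriv F.ψ) (linPred (fun i => M.row i ω) (M.thetaStar ω + u) i) ≤ LamR) ∧
    errorBound M σmin lamR lam ν ≤ R

end Conditions

end

/-! ### Nets of the unit sphere -/

section Nets

variable {E : Type*} [NormedAddCommGroup E] [NormedSpace ℝ E] [FiniteDimensional ℝ E]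

/-! The bound combines a convexity argument, valid on a good event, with a uniform estimate for the
random design.

Let `δ` be the claimed bound and suppose that a minimizer is farther than `δ` from `θ*`. Convexity
of the penalized objective lets one move back along the segment to `θ* + v` with `‖v‖ = 3δ/4`, where
the objective is still at most its value at `θ*`. This point lies in the ball where `ψ'' ≥ λ_R`, so
`ℓ` exceeds its tangent at `θ*` by at least `λ_R/2` times the mean square of the predictors of `v`
(`negLogLik_add_fderiv_add_le`). As `λ ≥ 2ν` and `ξ*` vanishes off the `k` mismatches, this excess
is at most `(λ+ν)√(d+k)‖v‖`, and the `ξ`-part of `v` has `ℓ¹` norm at most `4√(d+k)‖v‖`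
(`penNegLogLik_basic_inequality`). On that cone the mean square is at least `σmin/8 ‖v‖²`
(`restricted_strong_convexity`), whence `‖v‖ ≤ δ/2`, a contradiction
(`norm_sub_le_of_isPenMinimizer`).

Restricted strong convexity can fail only through the cross term `√n ∑ ⟨x_i, β⟩ ξ_i`. An
`ℓ¹`-controlled `ξ` can align only with the largest `|⟨x_i, β⟩|`, so it suffices that every sum of
at most `d+k` of the `⟨x_i, β⟩²` is a small fraction of `n‖β‖²`, while the full sum is at least
`σmin n‖β‖²/4`. Both bounds hold with probability `1 - 2/n` (`measure_not_quadraticForm_bounds_le`):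
whiten the rows, apply Chernoff bounds at the points of a net of the sphere, and extend by seminorm
arguments. All index sets of size at most `s` are handled at once through the excesses `(⟨w,
z_i⟩²/L² - τ)₊` with `τ = log (n/s)`, with no union bound over index sets. -/

open Metric Module in
/-- A volumetric bound for separated sets in the unit ball. -/
theorem card_le_of_separated_unitBall {ε : ℝ} (hε : 0 < ε) (s : Finset E) (hs : ∀ c ∈ s, ‖c‖ ≤ 1)
    (h : ∀ c ∈ s, ∀ d ∈ s, c ≠ d → ε ≤ ‖c - d‖) :
    (s.card : ℝ) ≤ (1 + 2 / ε) ^ finrank ℝ E := by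
  borelize E
  let μ : Measure E := Measure.addHaar
  set δ : ℝ := ε / 2 with hδdef
  set ρ : ℝ := 1 + δ with hρdef
  have δpos : 0 < δ := by positivity
  have ρpos : 0 < ρ := by positivity
  -- Balls of radius `ε/2` around the points are disjoint and lie in the ball of radius `1 + ε/2`;
  -- compare volumes.
  set A := ⋃ c ∈ s, ball (c : E) δ with hA
  have D : Set.Pairwise (s : Set E) (Function.onFun Disjoint fun c => ball (c : E) δ) := by
    rintro c hc d hd hcd
    apply ball_disjoint_ball
    rw [dist_eq_norm]
    convert h c hc d hd hcd
    simp [δ]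
  have A_subset : A ⊆ ball (0 : E) ρ := by
    refine Set.iUnion₂_subset fun x hx => ?_
    apply ball_subset_ball'
    have := hs x hx
    rw [dist_zero_right]
    linarith
  have I :
    (s.card : ℝ≥0∞) * ENNReal.ofReal (δ ^ finrank ℝ E) * μ (ball 0 1) ≤
      ENNReal.ofReal (ρ ^ finrank ℝ E) * μ (ball 0 1) :=
    calc
      (s.card : ℝ≥0∞) * ENNReal.ofReal (δ ^ finrank ℝ E) * μ (ball 0 1) = μ A := by
        rw [hA, measure_biUnion_finset D fun c _ => measurableSet_ball]
        simp only [μ.addHaar_ball_of_pos _ δpos]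
        simp only [Finset.sum_const, nsmul_eq_mul, mul_assoc]
      _ ≤ μ (ball (0 : E) ρ) := measure_mono A_subset
      _ = ENNReal.ofReal (ρ ^ finrank ℝ E) * μ (ball 0 1) := by
        simp only [μ.addHaar_ball_of_pos _ ρpos]
  have J : (s.card : ℝ≥0∞) * ENNReal.ofReal (δ ^ finrank ℝ E) ≤ ENNReal.ofReal (ρ ^ finrank ℝ E) :=
    (ENNReal.mul_le_mul_iff_left (measure_ball_pos _ _ zero_lt_one).ne' measure_ball_lt_top.ne).1 I
  have K := ENNReal.toReal_le_of_le_ofReal (pow_nonneg ρpos.le _) J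
  rw [ENNReal.toReal_mul, ENNReal.toReal_natCast, ENNReal.toReal_ofReal (by positivity),
    ← le_div_iff₀ (by positivity), ← div_pow] at K
  refine K.trans_eq ?_
  congr 1
  rw [hρdef, hδdef]
  field_simp
  ring

/-- The unit sphere has an `ε`-net of cardinality at most `(1 + 2 / ε) ^ dim`. -/
theorem exists_net_unitSphere {ε : ℝ} (hε : 0 < ε) :
    ∃ s : Finset E, (∀ c ∈ s, ‖c‖ = 1) ∧ (s.card : ℝ) ≤ (1 + 2 / ε) ^ Module.finrank ℝ E ∧
      ∀ v : E, ‖v‖ = 1 → ∃ w ∈ s, ‖v - w‖ ≤ ε := by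
  classical
  -- An `ε`-separated subset of maximal cardinality is a net: a point farther than `ε` from all of
  -- it could be added.
  let Q : ℕ → Prop := fun m => ∃ s : Finset E, s.card = m ∧ (∀ c ∈ s, ‖c‖ = 1) ∧
    ∀ c ∈ s, ∀ d ∈ s, c ≠ d → ε ≤ ‖c - d‖
  have hb : ∀ m, Q m → m ≤ ⌊(1 + 2 / ε) ^ Module.finrank ℝ E⌋₊ := by
    rintro m ⟨s, rfl, h1, h2⟩
    exact Nat.le_floor (card_le_of_separated_unitBall hε s (fun c hc => (h1 c hc).le) h2)
  have h0 : Q 0 := ⟨∅, by simp⟩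
  obtain ⟨s, hcard, h1, h2⟩ := Nat.findGreatest_spec (P := Q) (hb 0 h0) h0
  refine ⟨s, h1, card_le_of_separated_unitBall hε s (fun c hc => (h1 c hc).le) h2, ?_⟩
  intro v hv
  by_contra! hcon
  have hvs : v ∉ s := fun hmem => by
    have := hcon v hmem
    simp at this
    linarith
  have hQ : Q (s.card + 1) := by
    refine ⟨insert v s, Finset.card_insert_of_notMem hvs, ?_, ?_⟩
    · intro c hc
      rcases Finset.mem_insert.1 hc with rfl | hc
      exacts [hv, h1 c hc]
    · intro c hc d hd hcd
      rcases Finset.mem_insert.1 hc with hc | hc <;> rcases Finset.mem_insert.1 hd with hd | hd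
      · exact absurd (hc.trans hd.symm) hcd
      · exact hc ▸ (hcon d hd).le
      · rw [norm_sub_rev]; exact hd ▸ (hcon c hc).le
      · exact h2 c hc d hd hcd
  have := Nat.le_findGreatest (hb _ hQ) hQ
  omega

/-- A seminorm that is at most `b` on a `1/2`-net of the sphere is at most `2 b` on the sphere. -/
theorem Seminorm.le_two_mul_of_net (p : Seminorm ℝ E) {s : Set E} {b ε : ℝ}
    (hε : ε ≤ 1 / 2) (hnet : ∀ v : E, ‖v‖ = 1 → ∃ w ∈ s, ‖v - w‖ ≤ ε) (hb : ∀ w ∈ s, p w ≤ b)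
    (v : E) : p v ≤ 2 * b * ‖v‖ := by
  by_cases hv : v = 0
  · simp [hv]
  have hvn : 0 < ‖v‖ := norm_pos_iff.2 hv
  have hne : (Metric.sphere (0 : E) 1).Nonempty := ⟨‖v‖⁻¹ • v, by simp [norm_smul, hvn.ne']⟩
  have hcont : Continuous p := by
    simpa [continuousOn_univ] using p.convexOn.continuousOn_interior
  -- At a maximizer `u` with nearby net point `w`, `p u ≤ p w + p (u - w) ≤ b + p u / 2`.
  obtain ⟨u, hu, hmax⟩ := (isCompact_sphere (0 : E) 1).exists_isMaxOn hne hcont.continuousOn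
  have hscale : ∀ x : E, p x ≤ p u * ‖x‖ := by
    intro x
    by_cases hx : x = 0
    · simp [hx]
    have hxn : 0 < ‖x‖ := norm_pos_iff.2 hx
    have h1 : p (‖x‖⁻¹ • x) ≤ p u := hmax (by simp [norm_smul, hxn.ne'])
    rw [map_smul_eq_mul, norm_inv, norm_norm, inv_mul_le_iff₀ hxn] at h1
    linarith
  have hun : ‖u‖ = 1 := by simpa using hu
  obtain ⟨w, hw, hdist⟩ := hnet u hun
  have h2 : p u ≤ p w + p (u - w) := by
    have := map_add_le_add p w (u - w)
    simpa using this
  have h3 : p (u - w) ≤ p u * (1 / 2) :=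
    (hscale _).trans (mul_le_mul_of_nonneg_left (hdist.trans hε) (apply_nonneg p u))
  have h4 := hb w hw
  have h5 : p u ≤ 2 * b := by linarith
  exact (hscale v).trans (mul_le_mul_of_nonneg_right h5 hvn.le)

end Nets

/-! ### Partial sums of squares as seminorms -/

section SumSq

variable {ι E : Type*} [NormedAddCommGroup E] [InnerProductSpace ℝ E]

/-- The seminorm `v ↦ (∑ i ∈ T, ⟪v, z i⟫²) ^ (1/2)`. -/
noncomputable def innerSeminorm (z : ι → E) (T : Finset ι) : Seminorm ℝ E :=
  (normSeminorm ℝ (EuclideanSpace ℝ T)).comp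
    ((WithLp.linearEquiv 2 ℝ (T → ℝ)).symm.toLinearMap ∘ₗ
      LinearMap.pi fun i : T => (innerₛₗ ℝ (z i) : E →ₗ[ℝ] ℝ))

theorem innerSeminorm_sq (z : ι → E) (T : Finset ι) (v : E) :
    innerSeminorm z T v ^ 2 = ∑ i ∈ T, inner ℝ v (z i) ^ 2 := by
  have : innerSeminorm z T v = ‖(WithLp.toLp 2 fun i : T => inner ℝ (z i) v : EuclideanSpace ℝ T)‖ :=
    rfl
  rw [this, EuclideanSpace.real_norm_sq_eq, ← Finset.sum_coe_sort T]
  simp [real_inner_comm]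

end SumSq

/-! ### Exponential moments and tails -/

section Tails

variable {Ω : Type*} [MeasurableSpace Ω] {P : Measure Ω}

/-- Chernoff bound for a sum of independent random variables. -/
theorem measure_le_sum_le_of_iIndepFun {n : ℕ} {f : Fin n → Ω → ℝ} (hind : iIndepFun f P)
    (hf : ∀ i, Measurable (f i)) {b : ℝ} (hb : 0 ≤ b)
    (hexp : ∀ i, ∫⁻ ω, ENNReal.ofReal (Real.exp (f i ω)) ∂P ≤ ENNReal.ofReal b) (t : ℝ) :
    P {ω | t ≤ ∑ i, f i ω} ≤ ENNReal.ofReal (b ^ n * Real.exp (-t)) := by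
  have hg : Measurable fun x : ℝ => ENNReal.ofReal (Real.exp x) := by fun_prop
  have hprod : ∫⁻ ω, ENNReal.ofReal (Real.exp (∑ i, f i ω)) ∂P ≤ ENNReal.ofReal b ^ n := by
    have h1 := lintegral_prod_eq_prod_lintegral_of_indepFun Finset.univ
      (fun i ω => ENNReal.ofReal (Real.exp (f i ω))) (hind.comp (fun _ => _) fun _ => hg)
      fun i => hg.comp (hf i)
    have h2 : ∀ ω, ENNReal.ofReal (Real.exp (∑ i, f i ω)) =
        ∏ i, ENNReal.ofReal (Real.exp (f i ω)) := fun ω => by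
      rw [Real.exp_sum, ENNReal.ofReal_prod_of_nonneg fun i _ => (Real.exp_pos _).le]
    simp_rw [h2]
    rw [h1]
    refine (Finset.prod_le_prod' fun i _ => hexp i).trans ?_
    simp
  have hM := meas_ge_le_lintegral_div (μ := P)
    (f := fun ω => ENNReal.ofReal (Real.exp (∑ i, f i ω))) (ε := ENNReal.ofReal (Real.exp t))
    (hg.comp (Finset.measurable_fun_sum _ fun i _ => hf i)).aemeasurable
    (by simpa using Real.exp_pos t) ENNReal.ofReal_ne_top
  have hset : {ω | t ≤ ∑ i, f i ω} ⊆
      {ω | ENNReal.ofReal (Real.exp t) ≤ ENNReal.ofReal (Real.exp (∑ i, f i ω))} := fun ω hω =>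
    ENNReal.ofReal_le_ofReal (Real.exp_le_exp.2 hω)
  refine (measure_mono hset).trans (hM.trans ?_)
  rw [Real.exp_neg, ← div_eq_mul_inv, ENNReal.ofReal_div_of_pos (Real.exp_pos t),
    ENNReal.ofReal_pow hb]
  gcongr

theorem integrable_exp_of_lintegral_le {f : Ω → ℝ} (hf : Measurable f) {C : ℝ≥0∞} (hC : C ≠ ∞)
    (h : ∫⁻ ω, ENNReal.ofReal (Real.exp (f ω)) ∂P ≤ C) :
    Integrable (fun ω => Real.exp (f ω)) P := by
  refine ⟨(Real.measurable_exp.comp hf).aestronglyMeasurable, ?_⟩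
  rw [hasFiniteIntegral_iff_ofReal (Filter.Eventually.of_forall fun ω => (Real.exp_pos _).le)]
  exact h.trans_lt (lt_top_iff_ne_top.2 hC)

/-- Since `exp x ≥ 1 + x + x²/2`, it is enough that `(1 - x + x²/2)(1 + x + x²/2) = 1 + x⁴/4 ≥ 1`.
-/
theorem exp_neg_le_one_sub_add_sq {x : ℝ} (hx : 0 ≤ x) : Real.exp (-x) ≤ 1 - x + x ^ 2 / 2 := by
  have h := Real.quadratic_le_exp_of_nonneg hx
  rw [Real.exp_neg, inv_le_comm₀ (Real.exp_pos x) (by nlinarith [sq_nonneg (x - 1)])]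
  refine le_trans ?_ h
  rw [inv_le_iff_one_le_mul₀ (by nlinarith [sq_nonneg (x - 1)])]
  nlinarith [sq_nonneg x, sq_nonneg (x ^ 2)]

/-- The Laplace transform of the square of a sub-Gaussian variable with unit second moment. -/
theorem lintegral_exp_neg_sq_le [IsProbabilityMeasure P] {b : Ω → ℝ} (hb : Measurable b) {L η : ℝ}
    (hL : 0 < L) (hη : 0 ≤ η)
    (hsub : ∫⁻ ω, ENNReal.ofReal (Real.exp (b ω ^ 2 / L ^ 2)) ∂P ≤ 2)
    (hvar : ∫ ω, b ω ^ 2 ∂P = 1) :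
    ∫⁻ ω, ENNReal.ofReal (Real.exp (-(η * b ω ^ 2))) ∂P ≤
      ENNReal.ofReal (Real.exp (-η + η ^ 2 * L ^ 4)) := by
  have hint : Integrable (fun ω => Real.exp (b ω ^ 2 / L ^ 2)) P :=
    integrable_exp_of_lintegral_le (by fun_prop) (by simp) hsub
  -- Otherwise the integral would take its default value `0`, not `1`.
  have hint2 : Integrable (fun ω => b ω ^ 2) P := by
    by_contra h
    rw [integral_undef h] at hvar
    norm_num at hvar
  have hle2 : ∫ ω, Real.exp (b ω ^ 2 / L ^ 2) ∂P ≤ 2 := by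
    rw [integral_eq_lintegral_of_nonneg_ae
      (Filter.Eventually.of_forall fun ω => (Real.exp_pos _).le) hint.1]
    simpa using ENNReal.toReal_mono (by simp) hsub
  -- The quadratic term `η²b⁴/2` equals `η²L⁴ y²/2` with `y = b²/L²`, and `y²/2 ≤ exp y - 1`, whose
  -- mean is at most `1`.
  have hpt : ∀ ω, Real.exp (-(η * b ω ^ 2)) ≤
      1 - η * b ω ^ 2 + η ^ 2 * L ^ 4 * (Real.exp (b ω ^ 2 / L ^ 2) - 1) := fun ω => by
    have h1 := exp_neg_le_one_sub_add_sq (x := η * b ω ^ 2) (by positivity)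
    have h2 := Real.quadratic_le_exp_of_nonneg (x := b ω ^ 2 / L ^ 2) (by positivity)
    have h3 : (b ω ^ 2 / L ^ 2) ^ 2 / 2 ≤ Real.exp (b ω ^ 2 / L ^ 2) - 1 := by
      have : 0 ≤ b ω ^ 2 / L ^ 2 := by positivity
      linarith
    have h4 := mul_le_mul_of_nonneg_left h3 (by positivity : 0 ≤ η ^ 2 * L ^ 4)
    have h5 : η ^ 2 * L ^ 4 * ((b ω ^ 2 / L ^ 2) ^ 2 / 2) = (η * b ω ^ 2) ^ 2 / 2 := by
      field_simp
    linarith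
  have hI1 : Integrable (fun ω => 1 - η * b ω ^ 2) P :=
    (integrable_const _).sub (hint2.const_mul η)
  have hI2 : Integrable (fun ω => η ^ 2 * L ^ 4 * (Real.exp (b ω ^ 2 / L ^ 2) - 1)) P :=
    (hint.sub (integrable_const _)).const_mul _
  have hI : Integrable (fun ω => Real.exp (-(η * b ω ^ 2))) P := by
    refine (hI1.add hI2).mono' (by fun_prop) (Filter.Eventually.of_forall fun ω => ?_)
    rw [Real.norm_eq_abs, abs_of_pos (Real.exp_pos _)]
    exact hpt ω
  rw [← ofReal_integral_eq_lintegral_ofReal hI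
    (Filter.Eventually.of_forall fun ω => (Real.exp_pos _).le)]
  refine ENNReal.ofReal_le_ofReal ?_
  calc ∫ ω, Real.exp (-(η * b ω ^ 2)) ∂P
      ≤ ∫ ω, (1 - η * b ω ^ 2 + η ^ 2 * L ^ 4 * (Real.exp (b ω ^ 2 / L ^ 2) - 1)) ∂P :=
        integral_mono hI (hI1.add hI2) hpt
    _ = 1 - η + η ^ 2 * L ^ 4 * (∫ ω, Real.exp (b ω ^ 2 / L ^ 2) ∂P - 1) := by
        rw [integral_add hI1 hI2, integral_sub (integrable_const _) (hint2.const_mul η),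
          integral_const_mul, integral_const_mul, integral_sub hint (integrable_const _), hvar]
        simp
    _ ≤ (-η + η ^ 2 * L ^ 4) + 1 := by
        have := mul_le_mul_of_nonneg_left (sub_le_sub_right hle2 1)
          (by positivity : 0 ≤ η ^ 2 * L ^ 4)
        linarith
    _ ≤ _ := Real.add_one_le_exp _

/-- Pointwise, `exp (max (a - τ) 0) ≤ 1 + exp (-τ) exp a`. A high threshold thus makes the
exponential moment of the excess close to `1`, so that its `n`-th power stays under control. -/
theorem lintegral_exp_posPart_sub_le [IsProbabilityMeasure P] {a : Ω → ℝ} (ha : Measurable a)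
    (hexp : ∫⁻ ω, ENNReal.ofReal (Real.exp (a ω)) ∂P ≤ 2) (τ : ℝ) :
    ∫⁻ ω, ENNReal.ofReal (Real.exp (max (a ω - τ) 0)) ∂P ≤
      ENNReal.ofReal (1 + 2 * Real.exp (-τ)) := by
  have hpt : ∀ ω, ENNReal.ofReal (Real.exp (max (a ω - τ) 0)) ≤
      1 + ENNReal.ofReal (Real.exp (-τ)) * ENNReal.ofReal (Real.exp (a ω)) := fun ω => by
    rw [← ENNReal.ofReal_mul (Real.exp_pos _).le, ← ENNReal.ofReal_one,
      ← ENNReal.ofReal_add zero_le_one (by positivity), ← Real.exp_add]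
    refine ENNReal.ofReal_le_ofReal ?_
    rcases le_total (a ω - τ) 0 with h | h
    · rw [max_eq_right h, Real.exp_zero]
      linarith [Real.exp_pos (-τ + a ω)]
    · rw [max_eq_left h, sub_eq_neg_add]
      linarith
  refine (lintegral_mono hpt).trans ?_
  rw [lintegral_add_left measurable_const, lintegral_const_mul _ (by fun_prop)]
  rw [ENNReal.ofReal_add zero_le_one (by positivity), mul_comm 2,
    ENNReal.ofReal_mul (Real.exp_pos _).le]
  simp only [lintegral_const, measure_univ, mul_one, ENNReal.ofReal_one, ENNReal.ofReal_ofNat]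
  gcongr

end Tails

/-! ### Uniform bounds for isotropic sub-Gaussian designs -/

section Design

variable {Ω : Type*} [MeasurableSpace Ω] {P : Measure Ω} [IsProbabilityMeasure P]
  {E : Type*} [NormedAddCommGroup E] [InnerProductSpace ℝ E] [FiniteDimensional ℝ E]

/-- If, on an `ε`-net of the unit sphere, the quadratic form of the vectors `z i` is bounded from
above and from below, and so are its largest partial sums, then the same holds everywhere. -/
theorem quadraticForm_bounds_of_net {n : ℕ} {L s B : ℝ} (hL : 1 ≤ L) {N : Set E}
    (hnet : ∀ v : E, ‖v‖ = 1 → ∃ w ∈ N, ‖v - w‖ ≤ 1 / (20 * L))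
    {τ : ℝ} (hτ : 0 ≤ τ) (z : Fin n → E)
    (hlow : ∀ w ∈ N, (n : ℝ) / 2 ≤ ∑ i, inner ℝ w (z i) ^ 2)
    (hupp : ∀ w ∈ N, ∑ i, inner ℝ w (z i) ^ 2 / L ^ 2 ≤ 3 * n)
    (htop : ∀ w ∈ N, ∑ i, max (inner ℝ w (z i) ^ 2 / L ^ 2 - τ) 0 ≤ B) :
    (∀ v : E, (n : ℝ) / 4 * ‖v‖ ^ 2 ≤ ∑ i, inner ℝ v (z i) ^ 2) ∧
      ∀ T : Finset (Fin n), (T.card : ℝ) ≤ s → ∀ v : E,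
        ∑ i ∈ T, inner ℝ v (z i) ^ 2 ≤ 4 * L ^ 2 * (s * τ + B) * ‖v‖ ^ 2 := by
  have hL0 : 0 < L := by linarith
  have hε : 1 / (20 * L) ≤ 1 / 2 := by
    apply one_div_le_one_div_of_le <;> linarith
  set p := innerSeminorm z Finset.univ with hp
  have hpsq : ∀ v, p v ^ 2 = ∑ i, inner ℝ v (z i) ^ 2 := innerSeminorm_sq z Finset.univ
  set r := Real.sqrt n with hr
  have hr0 : 0 ≤ r := Real.sqrt_nonneg _
  have hrsq : r ^ 2 = n := Real.sq_sqrt (Nat.cast_nonneg n)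
  have hop : ∀ v, p v ≤ 2 * (2 * L * r) * ‖v‖ := p.le_two_mul_of_net hε hnet fun w hw => by
    refine abs_le_of_sq_le_sq' ?_ (by positivity) |>.2
    rw [hpsq]
    have h1 := hupp w hw
    rw [← Finset.sum_div, div_le_iff₀ (by positivity)] at h1
    nlinarith [sq_nonneg L, hrsq, mul_nonneg (sq_nonneg L) (sq_nonneg r)]
  constructor
  -- The net gives `p w ≥ √(n/2) ≥ 0.7 r`, and the resolution `1/(20L)` against the global bound
  -- `4Lr` loses only `0.2 r`.
  · have hunit : ∀ v : E, ‖v‖ = 1 → r / 2 ≤ p v := fun v hv => by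
      obtain ⟨w, hw, hd⟩ := hnet v hv
      have h1 : 0.7 * r ≤ p w := by
        refine abs_le_of_sq_le_sq' ?_ (apply_nonneg p w) |>.2
        rw [hpsq]
        refine le_trans ?_ (hlow w hw)
        nlinarith
      have h2 : p w ≤ p v + p (v - w) := by
        have := map_sub_le_add p v (v - w)
        simpa using this
      have h3 : p (v - w) ≤ 0.2 * r := by
        refine (hop _).trans ((mul_le_mul_of_nonneg_left hd (by positivity)).trans ?_)
        apply le_of_eq
        field_simp
        ring
      linarith
    intro v
    by_cases hv : v = 0
    · simp [hv]
    have hvn : 0 < ‖v‖ := norm_pos_iff.2 hv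
    have h1 := hunit (‖v‖⁻¹ • v) (by simp [norm_smul, hvn.ne'])
    rw [map_smul_eq_mul, norm_inv, norm_norm, le_inv_mul_iff₀ hvn] at h1
    rw [← hpsq]
    have h2 := pow_le_pow_left₀ (by positivity) h1 2
    calc (n : ℝ) / 4 * ‖v‖ ^ 2 = (‖v‖ * (r / 2)) ^ 2 := by rw [← hrsq]; ring
      _ ≤ _ := h2
  · intro T hT v
    have hnetT : ∀ w ∈ N, innerSeminorm z T w ≤ L * Real.sqrt (s * τ + B) := fun w hw => by
      -- Each term is at most `τ` plus its excess over `τ`. The total excess over all indices is at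
      -- most `B`, whatever `T` is.
      have h1 : ∑ i ∈ T, inner ℝ w (z i) ^ 2 / L ^ 2 ≤ s * τ + B := by
        calc ∑ i ∈ T, inner ℝ w (z i) ^ 2 / L ^ 2
            ≤ ∑ i ∈ T, (τ + max (inner ℝ w (z i) ^ 2 / L ^ 2 - τ) 0) :=
              Finset.sum_le_sum fun i _ => by
                linarith [le_max_left (inner ℝ w (z i) ^ 2 / L ^ 2 - τ) 0]
          _ = T.card * τ + ∑ i ∈ T, max (inner ℝ w (z i) ^ 2 / L ^ 2 - τ) 0 := by
              rw [Finset.sum_add_distrib, Finset.sum_const, nsmul_eq_mul]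
          _ ≤ s * τ + ∑ i, max (inner ℝ w (z i) ^ 2 / L ^ 2 - τ) 0 := by
              gcongr
              exact T.subset_univ
          _ ≤ s * τ + B := by gcongr; exact htop w hw
      have h0 : 0 ≤ s * τ + B := le_trans (Finset.sum_nonneg fun i _ => by positivity) h1
      refine abs_le_of_sq_le_sq' ?_ (by positivity) |>.2
      rw [innerSeminorm_sq, mul_pow, Real.sq_sqrt h0, mul_comm, ← div_le_iff₀ (by positivity),
        Finset.sum_div]
      exact h1
    by_cases hv : v = 0
    · simp [hv]
    have hvn : 0 < ‖v‖ := norm_pos_iff.2 hv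
    -- Only the existence of a net point matters here: it forces `0 ≤ B`.
    obtain ⟨w, hw, -⟩ := hnet (‖v‖⁻¹ • v) (by simp [norm_smul, hvn.ne'])
    have h0 : 0 ≤ s * τ + B := by
      have h1 : 0 ≤ s := le_trans (Nat.cast_nonneg _) hT
      have h2 : 0 ≤ B := le_trans (Finset.sum_nonneg fun i _ => le_max_right _ _) (htop w hw)
      positivity
    have h1 := (innerSeminorm z T).le_two_mul_of_net hε hnet hnetT v
    have h2 := pow_le_pow_left₀ (apply_nonneg _ _) h1 2
    rw [innerSeminorm_sq] at h2
    refine h2.trans (le_of_eq ?_)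
    rw [mul_pow, mul_pow, mul_pow, Real.sq_sqrt h0]
    ring

variable [MeasurableSpace E] [BorelSpace E]

/-- Uniform bounds for the sample covariance of independent, isotropic, sub-Gaussian vectors, and
for its partial sums over few observations. -/
theorem measure_not_quadraticForm_bounds_le {n : ℕ} (hn : 0 < n) {Z : Fin n → Ω → E}
    (hind : iIndepFun Z P) (hZ : ∀ i, Measurable (Z i)) {L : ℝ} (hL : 1 ≤ L)
    (hsub : ∀ i, ∀ v : E, ‖v‖ = 1 →
      ∫⁻ ω, ENNReal.ofReal (Real.exp (inner ℝ v (Z i ω) ^ 2 / L ^ 2)) ∂P ≤ 2)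
    (hvar : ∀ i, ∀ v : E, ‖v‖ = 1 → ∫ ω, inner ℝ v (Z i ω) ^ 2 ∂P = 1)
    {s : ℝ} (hs : 0 < s) (hsn : s ≤ n)
    (hdim : Module.finrank ℝ E * Real.log (1 + 40 * L) ≤ n / (32 * L ^ 4))
    (hlog : Real.log (2 * n) ≤ n / (32 * L ^ 4)) :
    P {ω | ¬ ((∀ v : E, (n : ℝ) / 4 * ‖v‖ ^ 2 ≤ ∑ i, inner ℝ v (Z i ω) ^ 2) ∧
      ∀ T : Finset (Fin n), (T.card : ℝ) ≤ s → ∀ v : E,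
        ∑ i ∈ T, inner ℝ v (Z i ω) ^ 2 ≤ 4 * L ^ 2 * (s * Real.log (n / s) +
          (2 * s + Module.finrank ℝ E * Real.log (1 + 40 * L) + Real.log n)) * ‖v‖ ^ 2)} ≤
      ENNReal.ofReal (2 / n) := by
  have hL0 : 0 < L := by linarith
  have hnR : (0 : ℝ) < n := by exact_mod_cast hn
  obtain ⟨N, hN1, hNcard, hnet⟩ := exists_net_unitSphere (E := E) (ε := 1 / (20 * L))
    (by positivity)
  have hDeq : 1 + 2 / (1 / (20 * L)) = 1 + 40 * L := by field_simp; ring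
  rw [hDeq] at hNcard
  set m := Module.finrank ℝ E
  -- `G` bounds the logarithm of the cardinality of the net, hence the cost of a union bound over
  -- it.
  set G := (m : ℝ) * Real.log (1 + 40 * L) with hG
  have hcardexp : (N.card : ℝ) ≤ Real.exp G := by
    rw [hG, mul_comm, Real.exp_mul, Real.exp_log (by positivity), Real.rpow_natCast]
    exact hNcard
  set τ := Real.log (n / s) with hτ
  have hτ0 : 0 ≤ τ := Real.log_nonneg ((one_le_div hs).2 hsn)
  -- As `exp (-τ) = s/n`, the excesses have joint exponential moment at most `(1 + 2s/n)^n ≤ exp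
  -- (2s)`. The term `2s` pays for this, `G` for the net, and `log n` leaves probability `1/n`.
  set B := 2 * s + G + Real.log n with hB
  -- The event that the quadratic form at `w` is at most `n/2`, scaled by `η = 1/(4L⁴)`, the
  -- minimizer of the Chernoff exponent `-η/2 + η²L⁴`, whose value there is `-1/(16L⁴)`.
  let A₁ : E → Set Ω := fun w => {ω | -(1 / (4 * L ^ 4) * (n / 2)) ≤
    ∑ i, -(1 / (4 * L ^ 4) * inner ℝ w (Z i ω) ^ 2)}
  let A₂ : E → Set Ω := fun w => {ω | 3 * n ≤ ∑ i, inner ℝ w (Z i ω) ^ 2 / L ^ 2}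
  let A₃ : E → Set Ω := fun w => {ω | B ≤ ∑ i, max (inner ℝ w (Z i ω) ^ 2 / L ^ 2 - τ) 0}
  have h16 : -((n : ℝ) / (16 * L ^ 4)) = -(n / (32 * L ^ 4)) - n / (32 * L ^ 4) := by
    field_simp; ring
  have hA₁ : ∀ w ∈ N, P (A₁ w) ≤ ENNReal.ofReal (Real.exp (-(n / (16 * L ^ 4)))) := by
    intro w hw
    refine (measure_le_sum_le_of_iIndepFun
      (f := fun i ω => -(1 / (4 * L ^ 4) * inner ℝ w (Z i ω) ^ 2))
      (hind.comp (fun _ x => -(1 / (4 * L ^ 4) * inner ℝ w x ^ 2)) fun _ => by fun_prop)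
      (fun i => by fun_prop) (Real.exp_pos _).le
      (fun i => lintegral_exp_neg_sq_le (b := fun ω => inner ℝ w (Z i ω)) (by fun_prop) hL0
        (by positivity) (hsub i w (hN1 w hw)) (hvar i w (hN1 w hw))) _).trans ?_
    refine ENNReal.ofReal_le_ofReal (le_of_eq ?_)
    rw [← Real.exp_nat_mul, ← Real.exp_add]
    congr 1
    field_simp
    ring
  have hA₂ : ∀ w ∈ N, P (A₂ w) ≤ ENNReal.ofReal (Real.exp (-(n / (16 * L ^ 4)))) := by
    intro w hw
    refine (measure_le_sum_le_of_iIndepFun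
      (f := fun i ω => inner ℝ w (Z i ω) ^ 2 / L ^ 2)
      (hind.comp (fun _ x => inner ℝ w x ^ 2 / L ^ 2) fun _ => by fun_prop)
      (fun i => by fun_prop) zero_le_two
      (fun i => by simpa using hsub i w (hN1 w hw)) _).trans ?_
    refine ENNReal.ofReal_le_ofReal ?_
    have h2 : (2 : ℝ) ≤ Real.exp 1 := by linarith [Real.add_one_le_exp (1 : ℝ)]
    calc (2 : ℝ) ^ n * Real.exp (-(3 * n)) ≤ Real.exp 1 ^ n * Real.exp (-(3 * n)) := by gcongr
      _ = Real.exp (-(2 * n)) := by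
        rw [← Real.exp_nat_mul, ← Real.exp_add]; congr 1; ring
      _ ≤ _ := by
        refine Real.exp_le_exp.2 (neg_le_neg ?_)
        rw [div_le_iff₀ (by positivity)]
        have : 1 ≤ L ^ 4 := one_le_pow₀ hL
        nlinarith
  have hA₃ : ∀ w ∈ N, P (A₃ w) ≤ ENNReal.ofReal (Real.exp (-(G + Real.log n))) := by
    intro w hw
    refine (measure_le_sum_le_of_iIndepFun
      (f := fun i ω => max (inner ℝ w (Z i ω) ^ 2 / L ^ 2 - τ) 0)
      (hind.comp (fun _ x => max (inner ℝ w x ^ 2 / L ^ 2 - τ) 0) fun _ => by fun_prop)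
      (fun i => by fun_prop) (by positivity)
      (fun i => lintegral_exp_posPart_sub_le (a := fun ω => inner ℝ w (Z i ω) ^ 2 / L ^ 2)
        (by fun_prop) (hsub i w (hN1 w hw)) τ) _).trans ?_
    refine ENNReal.ofReal_le_ofReal ?_
    have hexpτ : Real.exp (-τ) = s / n := by
      rw [hτ, Real.exp_neg, Real.exp_log (by positivity), inv_div]
    calc (1 + 2 * Real.exp (-τ)) ^ n * Real.exp (-B)
        ≤ Real.exp (2 * Real.exp (-τ)) ^ n * Real.exp (-B) := by
          gcongr
          linarith [Real.add_one_le_exp (2 * Real.exp (-τ))]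
      _ = Real.exp (-(G + Real.log n)) := by
          rw [← Real.exp_nat_mul, ← Real.exp_add, hexpτ]
          congr 1
          rw [hB]
          field_simp
          ring
  have hunion : ∀ (A : E → Set Ω) (x : ℝ), (∀ w ∈ N, P (A w) ≤ ENNReal.ofReal (Real.exp x)) →
      P (⋃ w ∈ N, A w) ≤ ENNReal.ofReal (Real.exp (G + x)) := by
    intro A x hA
    refine (measure_biUnion_finset_le N A).trans ((Finset.sum_le_sum hA).trans ?_)
    rw [Finset.sum_const, nsmul_eq_mul, Real.exp_add, ENNReal.ofReal_mul (Real.exp_pos _).le,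
      ← ENNReal.ofReal_natCast]
    gcongr
  have hsubset : {ω | ¬ ((∀ v : E, (n : ℝ) / 4 * ‖v‖ ^ 2 ≤ ∑ i, inner ℝ v (Z i ω) ^ 2) ∧
      ∀ T : Finset (Fin n), (T.card : ℝ) ≤ s → ∀ v : E,
        ∑ i ∈ T, inner ℝ v (Z i ω) ^ 2 ≤ 4 * L ^ 2 * (s * τ + B) * ‖v‖ ^ 2)} ⊆
      ((⋃ w ∈ N, A₁ w) ∪ ⋃ w ∈ N, A₂ w) ∪ ⋃ w ∈ N, A₃ w := by
    intro ω hω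
    by_contra hcon
    simp only [Set.mem_union, Set.mem_iUnion, not_or, not_exists] at hcon
    obtain ⟨⟨h1, h2⟩, h3⟩ := hcon
    simp only [A₁, A₂, A₃, Set.mem_ofPred_eq, not_le] at h1 h2 h3
    refine hω (quadraticForm_bounds_of_net hL (N := N) hnet hτ0 _ (fun w hw => ?_)
      (fun w hw => (h2 w hw).le) fun w hw => (h3 w hw).le)
    have := (h1 w hw).le
    rw [Finset.sum_neg_distrib, ← Finset.mul_sum, neg_le_neg_iff] at this
    exact le_of_mul_le_mul_left this (by positivity)
  refine (measure_mono hsubset).trans ?_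
  refine (measure_union_le _ _).trans ((add_le_add (measure_union_le _ _) le_rfl).trans ?_)
  refine (add_le_add (add_le_add (hunion A₁ _ hA₁) (hunion A₂ _ hA₂)) (hunion A₃ _ hA₃)).trans ?_
  rw [← ENNReal.ofReal_add (Real.exp_pos _).le (Real.exp_pos _).le,
    ← ENNReal.ofReal_add (by positivity) (Real.exp_pos _).le]
  refine ENNReal.ofReal_le_ofReal ?_
  have e1 : Real.exp (G + -(n / (16 * L ^ 4))) ≤ 1 / (2 * n) := by
    rw [one_div, ← Real.exp_log (by positivity : (0 : ℝ) < 2 * n), ← Real.exp_neg]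
    refine Real.exp_le_exp.2 ?_
    linarith
  have e2 : Real.exp (G + -(G + Real.log n)) = 1 / n := by
    rw [neg_add, add_neg_cancel_left, Real.exp_neg, Real.exp_log hnR, one_div]
  have e3 : 1 / (2 * (n : ℝ)) + 1 / (2 * n) + 1 / n = 2 / n := by field_simp; norm_num
  linarith

end Design

/-! ### Convexity of the cumulant function -/

namespace ExpFamily

variable (F : ExpFamily)

/-- The cumulant function is convex on the natural parameter space. -/
theorem convexOn_ψ : ConvexOn ℝ F.Θ F.ψ := by
  -- Convexity of `exp` bounds the geometric mean of two densities by their arithmetic mean, which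
  -- integrates to `1`.
  have key : ∀ x ∈ F.Θ, ∀ y ∈ F.Θ, ∀ a b : ℝ, 0 ≤ a → 0 ≤ b → a + b = 1 →
      ∫⁻ z, ENNReal.ofReal (Real.exp ((z * (a * x + b * y) - (a * F.ψ x + b * F.ψ y)) / F.a + F.c z))
        ∂F.ref ≤ 1 := by
    intro x hx y hy a b ha hb hab
    have hm := F.measurable_c
    have hpt : ∀ z, ENNReal.ofReal
        (Real.exp ((z * (a * x + b * y) - (a * F.ψ x + b * F.ψ y)) / F.a + F.c z)) ≤
        ENNReal.ofReal a * ENNReal.ofReal (Real.exp ((z * x - F.ψ x) / F.a + F.c z)) +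
        ENNReal.ofReal b * ENNReal.ofReal (Real.exp ((z * y - F.ψ y) / F.a + F.c z)) := fun z => by
      rw [← ENNReal.ofReal_mul ha, ← ENNReal.ofReal_mul hb,
        ← ENNReal.ofReal_add (by positivity) (by positivity)]
      refine ENNReal.ofReal_le_ofReal ?_
      have := convexOn_exp.2 (Set.mem_univ ((z * x - F.ψ x) / F.a + F.c z))
        (Set.mem_univ ((z * y - F.ψ y) / F.a + F.c z)) ha hb hab
      simp only [smul_eq_mul] at this
      refine le_trans (le_of_eq ?_) this
      congr 1
      obtain rfl : b = 1 - a := by linarith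
      ring
    refine (lintegral_mono hpt).trans ?_
    rw [lintegral_add_left (by fun_prop), lintegral_const_mul _ (by fun_prop),
      lintegral_const_mul _ (by fun_prop), F.normalized x hx, F.normalized y hy, mul_one, mul_one,
      ← ENNReal.ofReal_add ha hb, hab, ENNReal.ofReal_one]
  -- Changing the normalizer rescales the integral. With `v = ψ ϑ` the integral on the right is `1`,
  -- so an integral at most `1` on the left means `ψ ϑ ≤ u`.
  have factor : ∀ ϑ u v : ℝ,
      ∫⁻ z, ENNReal.ofReal (Real.exp ((z * ϑ - u) / F.a + F.c z)) ∂F.ref =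
      ENNReal.ofReal (Real.exp ((v - u) / F.a)) *
        ∫⁻ z, ENNReal.ofReal (Real.exp ((z * ϑ - v) / F.a + F.c z)) ∂F.ref := fun ϑ u v => by
    have hm := F.measurable_c
    rw [← lintegral_const_mul _ (by fun_prop)]
    refine lintegral_congr fun z => ?_
    rw [← ENNReal.ofReal_mul (Real.exp_pos _).le, ← Real.exp_add]
    congr 2
    ring
  have hmem : ∀ ϑ u : ℝ,
      ∫⁻ z, ENNReal.ofReal (Real.exp ((z * ϑ - u) / F.a + F.c z)) ∂F.ref ≤ 1 → ϑ ∈ F.Θ := by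
    intro ϑ u h
    have h0 := factor ϑ 0 u
    simp only [sub_zero] at h0
    change ∫⁻ z, _ ∂F.ref < ∞
    rw [h0]
    exact ENNReal.mul_lt_top ENNReal.ofReal_lt_top (h.trans_lt ENNReal.one_lt_top)
  refine ⟨fun x hx y hy a b ha hb hab => hmem _ _ (key x hx y hy a b ha hb hab),
    fun x hx y hy a b ha hb hab => ?_⟩
  have h1 := key x hx y hy a b ha hb hab
  have h2 := hmem _ _ h1
  rw [factor _ _ (F.ψ (a * x + b * y)), F.normalized _ h2, mul_one, ← ENNReal.ofReal_one,
    ENNReal.ofReal_le_ofReal_iff zero_le_one, Real.exp_le_one_iff,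
    div_le_iff₀ F.a_pos, zero_mul] at h1
  simpa using h1

end ExpFamily

/-! ### Consequences of a lower bound on the second derivative -/

/-- A continuous function whose second derivative (in the sense of `deriv`) is positive on an
interval is differentiable there. -/
theorem differentiableAt_of_deriv_deriv_pos {f : ℝ → ℝ} {U : Set ℝ} (hU : IsOpen U)
    (hconv : Convex ℝ U) (hf : ContinuousOn f U) (h : ∀ x ∈ U, 0 < deriv (deriv f) x) {x : ℝ}
    (hx : x ∈ U) : DifferentiableAt ℝ f x := by
  -- The default value `0` of `deriv` is what has to be ruled out. Since `deriv f` is strictly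
  -- increasing, it vanishes at most once, so `x` would be the only point of non-differentiability.
  -- But `deriv f` is continuous at `x`, so its limits from both sides give one-sided derivatives of
  -- `f` that agree.
  by_contra hnd
  have hd : ∀ y ∈ U, DifferentiableAt ℝ (deriv f) y := fun y hy =>
    differentiableAt_of_deriv_ne_zero (h y hy).ne'
  have hmono : StrictMonoOn (deriv f) U :=
    strictMonoOn_of_deriv_pos hconv (fun y hy => (hd y hy).continuousAt.continuousWithinAt)
      fun y hy => h y (interior_subset hy)
  have hx0 : deriv f x = 0 := deriv_zero_of_not_differentiableAt hnd
  have hne : ∀ y ∈ U, y ≠ x → DifferentiableAt ℝ f y := fun y hy hyx => by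
    refine differentiableAt_of_deriv_ne_zero fun h0 => hyx ?_
    exact hmono.injOn hy hx (h0.trans hx0.symm)
  have hUx : U ∈ nhds x := hU.mem_nhds hx
  refine hnd (HasDerivAt.differentiableAt (f' := deriv f x) ?_)
  obtain ⟨l, u, ⟨hl, hu⟩, hsub⟩ := (mem_nhds_iff_exists_Ioo_subset).1 hUx
  have hdiff : ∀ y ∈ Set.Ioo l u, y ≠ x → HasDerivAt f (deriv f y) y := fun y hy hyx =>
    (hne y (hsub hy) hyx).hasDerivAt
  have hright : HasDerivWithinAt f (deriv f x) (Set.Ici x) x := by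
    refine hasDerivWithinAt_Ici_of_tendsto_deriv (s := Set.Ioo x u) (fun y hy =>
      (hdiff y ⟨hl.trans hy.1, hy.2⟩ hy.1.ne').differentiableAt.differentiableWithinAt)
      ((hf x hx).mono fun y hy => hsub ⟨hl.trans hy.1, hy.2⟩) (Ioo_mem_nhdsGT hu)
      ((hd x hx).continuousAt.tendsto.mono_left nhdsWithin_le_nhds)
  have hleft : HasDerivWithinAt f (deriv f x) (Set.Iic x) x := by
    refine hasDerivWithinAt_Iic_of_tendsto_deriv (s := Set.Ioo l x) (fun y hy =>
      (hdiff y ⟨hy.1, hy.2.trans hu⟩ hy.2.ne).differentiableAt.differentiableWithinAt)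
      ((hf x hx).mono fun y hy => hsub ⟨hy.1, hy.2.trans hu⟩) (Ioo_mem_nhdsLT hl)
      ((hd x hx).continuousAt.tendsto.mono_left nhdsWithin_le_nhds)
  have := hleft.union hright
  rwa [Set.Iic_union_Ici, hasDerivWithinAt_univ] at this

/-- A convex function with second derivative at least `κ` on an interval grows at least
quadratically away from its tangents. -/
theorem add_deriv_mul_add_sq_le {f : ℝ → ℝ} {U : Set ℝ} (hU : Convex ℝ U)
    (hd : ∀ x ∈ U, DifferentiableAt ℝ f x) {κ : ℝ} (hκ : 0 < κ)
    (h : ∀ x ∈ U, κ ≤ deriv (deriv f) x) {x y : ℝ} (hx : x ∈ U) (hy : y ∈ U) :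
    f x + deriv f x * (y - x) + κ / 2 * (y - x) ^ 2 ≤ f y := by
  -- `f` minus the parabola is still convex, hence above its tangent at `x`, which has slope `deriv
  -- f x`.
  set g : ℝ → ℝ := fun z => f z - κ / 2 * (z - x) ^ 2 with hg
  have hgd : ∀ z ∈ U, HasDerivAt g (deriv f z - κ * (z - x)) z := fun z hz => by
    have h1 := ((hasDerivAt_id z).sub_const x).pow 2
    have h2 := (hd z hz).hasDerivAt.sub (h1.const_mul (κ / 2))
    convert! h2 using 1
    simp
    ring
  have hmono : MonotoneOn (fun z => deriv f z - κ * (z - x)) U := by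
    have hdd : ∀ z ∈ U, HasDerivAt (fun z => deriv f z - κ * (z - x)) (deriv (deriv f) z - κ) z :=
      fun z hz => by
        have h1 := (differentiableAt_of_deriv_ne_zero (hκ.trans_le (h z hz)).ne').hasDerivAt
        have h2 := h1.sub (((hasDerivAt_id z).sub_const x).const_mul κ)
        convert! h2 using 1
        ring
    refine monotoneOn_of_deriv_nonneg hU
      (fun z hz => (hdd z hz).continuousAt.continuousWithinAt)
      (fun z hz => (hdd z (interior_subset hz)).differentiableAt.differentiableWithinAt)
      fun z hz => ?_
    rw [(hdd z (interior_subset hz)).deriv]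
    linarith [h z (interior_subset hz)]
  have hconv : ConvexOn ℝ U g := by
    refine MonotoneOn.convexOn_of_deriv hU (fun z hz => (hgd z hz).continuousAt.continuousWithinAt)
      (fun z hz => (hgd z (interior_subset hz)).differentiableAt.differentiableWithinAt) ?_
    refine (hmono.mono interior_subset).congr fun z hz => ?_
    exact (hgd z (interior_subset hz)).deriv.symm
  have hgx : g x = f x := by simp [hg]
  have hgx' := hgd x hx
  simp only [sub_self, mul_zero, sub_zero] at hgx'
  have key : g x + deriv f x * (y - x) ≤ g y := by
    rcases lt_trichotomy x y with hxy | rfl | hxy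
    · have := hconv.le_slope_of_hasDerivAt hx hy hxy hgx'
      rw [slope_def_field, le_div_iff₀ (sub_pos.2 hxy)] at this
      linarith
    · simp
    · have := hconv.slope_le_of_hasDerivAt hy hx hxy hgx'
      rw [slope_def_field, div_le_iff₀ (sub_pos.2 hxy)] at this
      linarith
  simp only [hg, sub_self] at key
  linarith

/-! ### Deterministic error bound -/

section Deterministic

/-- An inner product is controlled by the largest partial sums of squares of one factor together
with the `ℓ²` and `ℓ¹` norms of the other. -/
theorem abs_sum_mul_le_of_partial_sums {ι : Type*} [Fintype ι] {a ξ : ι → ℝ} {s : ℕ} (hs : 0 < s)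
    {g : ℝ} (hg : 0 ≤ g) (h : ∀ T : Finset ι, T.card ≤ s → ∑ i ∈ T, a i ^ 2 ≤ g ^ 2) :
    |∑ i, a i * ξ i| ≤ g * Real.sqrt (∑ i, ξ i ^ 2) + g / Real.sqrt s * ∑ i, |ξ i| := by
  classical
  have hsR : (0 : ℝ) < s := by exact_mod_cast hs
  -- At most `s` entries are this large, since `s` of them would already have sum of squares above
  -- `g²`. Use Cauchy–Schwarz on `T` and the sup bound off `T`.
  set T : Finset ι := Finset.univ.filter fun i => g / Real.sqrt s < |a i| with hT
  have hcard : T.card ≤ s := by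
    by_contra! hlt
    obtain ⟨T', hT', hcard'⟩ := Finset.exists_subset_card_eq hlt.le
    have h1 := h T' hcard'.le
    have h2 : ∑ i ∈ T', g ^ 2 / s < ∑ i ∈ T', a i ^ 2 := by
      refine Finset.sum_lt_sum_of_nonempty (Finset.card_pos.1 (hcard' ▸ hs)) fun i hi => ?_
      have h3 := (Finset.mem_filter.1 (hT' hi)).2
      have h4 := pow_lt_pow_left₀ h3 (by positivity) two_ne_zero
      rwa [div_pow, Real.sq_sqrt hsR.le, sq_abs] at h4
    rw [Finset.sum_const, hcard', nsmul_eq_mul, mul_div_cancel₀ _ hsR.ne'] at h2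
    exact h2.not_ge h1
  have hin : ∑ i ∈ T, |a i * ξ i| ≤ g * Real.sqrt (∑ i, ξ i ^ 2) := by
    have h1 := Real.sum_mul_le_sqrt_mul_sqrt T (fun i => |a i|) fun i => |ξ i|
    simp only [sq_abs, ← abs_mul] at h1
    refine h1.trans ?_
    gcongr
    · exact (Real.sqrt_le_left hg).2 (h T hcard)
    · exact T.subset_univ
  have hout : ∑ i ∈ Tᶜ, |a i * ξ i| ≤ g / Real.sqrt s * ∑ i, |ξ i| := by
    rw [Finset.mul_sum]
    refine (Finset.sum_le_sum fun i hi => ?_).trans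
      (Finset.sum_le_sum_of_subset_of_nonneg (Finset.subset_univ Tᶜ) fun i _ _ => by positivity)
    rw [abs_mul]
    gcongr
    simpa [hT] using hi
  calc |∑ i, a i * ξ i| ≤ ∑ i, |a i * ξ i| := Finset.abs_sum_le_sum_abs _ _
    _ = ∑ i ∈ T, |a i * ξ i| + ∑ i ∈ Tᶜ, |a i * ξ i| := (Finset.sum_add_sum_compl T _).symm
    _ ≤ _ := add_le_add hin hout

variable {d n : ℕ}

/-- `linPred` as a linear functional. -/
noncomputable def linPredCLM (X : Fin n → EuclideanSpace ℝ (Fin d)) (i : Fin n) : Param d n →L[ℝ] ℝ :=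
  LinearMap.toContinuousLinearMap
    { toFun := fun θ => linPred X θ i
      map_add' := fun θ u => by
        simp only [linPred, PiLp.add_apply, mul_add, Finset.sum_add_distrib]
        ring
      map_smul' := fun t θ => by
        simp only [linPred, PiLp.smul_apply, smul_eq_mul, RingHom.id_apply, mul_add,
          Finset.mul_sum]
        congr 1
        · exact Finset.sum_congr rfl fun a _ => by ring
        · ring }

theorem linPredCLM_apply (X : Fin n → EuclideanSpace ℝ (Fin d)) (i : Fin n) (θ : Param d n) :
    linPredCLM X i θ = linPred X θ i := rfl

theorem linPred_add (X : Fin n → EuclideanSpace ℝ (Fin d)) (θ u : Param d n) (i : Fin n) :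
    linPred X (θ + u) i = linPred X θ i + linPred X u i :=
  map_add (linPredCLM X i) θ u

theorem linPred_smul (X : Fin n → EuclideanSpace ℝ (Fin d)) (t : ℝ) (u : Param d n) (i : Fin n) :
    linPred X (t • u) i = t * linPred X u i :=
  map_smul (linPredCLM X i) t u

/-- The coordinate `ξ_i` enters with weight `√n > 0`, even if the row is zero. This makes the
predictor an open map. -/
theorem linPredCLM_ne_zero (X : Fin n → EuclideanSpace ℝ (Fin d)) (i : Fin n) :
    linPredCLM X i ≠ 0 := fun h => by
  have h1 : linPredCLM X i (EuclideanSpace.single (Sum.inr i) 1) = 0 := by rw [h]; rfl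
  rw [linPredCLM_apply] at h1
  have : 0 < n := i.pos
  simp [linPred] at h1
  omega

/-- The negative log-likelihood is strongly convex in the predictors near a parameter around which
the second derivative of the cumulant function is bounded from below. -/
theorem negLogLik_add_fderiv_add_le (F : ExpFamily) (X : Fin n → EuclideanSpace ℝ (Fin d))
    (y : Fin n → ℝ) {θ : Param d n} {R κ : ℝ} (hκ : 0 < κ)
    (h : ∀ i, ∀ u : Param d n, ‖u‖ ≤ R → linPred X (θ + u) i ∈ interior F.Θ ∧
      κ ≤ deriv (deriv F.ψ) (linPred X (θ + u) i))
    {v : Param d n} (hv : ‖v‖ < R) :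
    negLogLik F.ψ X y θ + fderiv ℝ (negLogLik F.ψ X y) θ v +
      κ / 2 * (1 / n * ∑ i, linPred X v i ^ 2) ≤ negLogLik F.ψ X y (θ + v) := by
  have hR : 0 < R := (norm_nonneg v).trans_lt hv
  -- The values of the `i`-th predictor on the open ball form an open interval on which the
  -- curvature bound holds, so the problem becomes one-dimensional.
  let U : Fin n → Set ℝ := fun i => (linPredCLM X i) '' Metric.ball θ R
  have hUopen : ∀ i, IsOpen (U i) := fun i =>
    (linPredCLM X i).isOpenMap_of_ne_zero (linPredCLM_ne_zero X i) _ Metric.isOpen_ball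
  have hUconv : ∀ i, Convex ℝ (U i) := fun i =>
    (convex_ball θ R).linear_image (linPredCLM X i).toLinearMap
  have hU : ∀ i, ∀ z ∈ U i, z ∈ interior F.Θ ∧ κ ≤ deriv (deriv F.ψ) z := by
    rintro i _ ⟨θ', hθ', rfl⟩
    have := h i (θ' - θ) (by simpa [dist_eq_norm] using (Metric.mem_ball.1 hθ').le)
    rwa [add_sub_cancel] at this
  have hcont : ContinuousOn F.ψ (interior F.Θ) := F.convexOn_ψ.continuousOn_interior
  have hd : ∀ i, ∀ z ∈ U i, DifferentiableAt ℝ F.ψ z := fun i z hz =>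
    differentiableAt_of_deriv_deriv_pos (hUopen i) (hUconv i)
      (hcont.mono fun z hz => (hU i z hz).1) (fun z hz => hκ.trans_le (hU i z hz).2) hz
  have hmem : ∀ i, linPred X θ i ∈ U i := fun i => ⟨θ, Metric.mem_ball_self hR, rfl⟩
  have hmem' : ∀ i, linPred X (θ + v) i ∈ U i := fun i => ⟨θ + v, by simpa using hv, rfl⟩
  have hfd : fderiv ℝ (negLogLik F.ψ X y) θ v =
      1 / n * (-(∑ i, linPred X v i * y i) + ∑ i, deriv F.ψ (linPred X θ i) * linPred X v i) := by
    have h1 : HasFDerivAt (negLogLik F.ψ X y)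
        ((1 / (n : ℝ)) • (-(∑ i, y i • linPredCLM X i) +
          ∑ i, deriv F.ψ (linPred X θ i) • linPredCLM X i)) θ := by
      refine HasFDerivAt.const_mul (HasFDerivAt.add (HasFDerivAt.neg (HasFDerivAt.fun_sum
        fun i _ => ?_)) (HasFDerivAt.fun_sum fun i _ => ?_)) (1 / (n : ℝ))
      · exact (linPredCLM X i).hasFDerivAt.mul_const (y i)
      · exact (hd i _ (hmem i)).hasDerivAt.comp_hasFDerivAt θ (linPredCLM X i).hasFDerivAt
    rw [h1.fderiv]
    simp only [smul_apply, add_apply, neg_apply, sum_apply, linPredCLM_apply, smul_eq_mul,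
      mul_comm (y _)]
  rw [hfd]
  have hi : ∀ i, F.ψ (linPred X θ i) + deriv F.ψ (linPred X θ i) * linPred X v i +
      κ / 2 * linPred X v i ^ 2 ≤ F.ψ (linPred X (θ + v) i) := fun i => by
    have := add_deriv_mul_add_sq_le (hUconv i) (hd i) hκ (fun z hz => (hU i z hz).2)
      (hmem i) (hmem' i)
    rwa [linPred_add, add_sub_cancel_left, ← linPred_add] at this
  have hsum := Finset.sum_le_sum fun i (_ : i ∈ Finset.univ) => hi i
  simp only [Finset.sum_add_distrib, ← Finset.mul_sum] at hsum
  have hsum' := mul_le_mul_of_nonneg_left hsum (by positivity : 0 ≤ 1 / (n : ℝ))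
  have hlin : ∑ i, linPred X (θ + v) i * y i =
      ∑ i, linPred X θ i * y i + ∑ i, linPred X v i * y i := by
    simp only [linPred_add, add_mul, Finset.sum_add_distrib]
  unfold negLogLik
  rw [hlin]
  linarith

theorem fderiv_ge_of_abs_gradient_le {f : Param d n → ℝ} {θ : Param d n} {ν : ℝ}
    (hgrad : ∀ s, |gradient f θ s| ≤ ν) (v : Param d n) :
    -(ν * (∑ a, |v (Sum.inl a)| + ∑ i, |v (Sum.inr i)|)) ≤ fderiv ℝ f θ v := by
  have h1 : fderiv ℝ f θ v = ∑ s, gradient f θ s * v s := by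
    rw [← toDual_gradient, InnerProductSpace.toDual_apply_apply, PiLp.inner_apply]
    simp [mul_comm]
  rw [h1, ← Fintype.sum_sum_type (fun s => |v s|), Finset.mul_sum]
  refine neg_le_of_abs_le ((Finset.abs_sum_le_sum_abs _ _).trans (Finset.sum_le_sum fun s _ => ?_))
  rw [abs_mul]
  exact mul_le_mul_of_nonneg_right (hgrad s) (abs_nonneg _)

/-- Cauchy–Schwarz on `d + |S|` coordinates. The entries of `β` carry no penalty and so count as
part of the support. -/
theorem sum_abs_add_sum_abs_le (v : Param d n) (S : Finset (Fin n)) :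
    ∑ a, |v (Sum.inl a)| + ∑ i ∈ S, |v (Sum.inr i)| ≤
      Real.sqrt ((d : ℝ) + S.card) * ‖v‖ := by
  have h1 : ∑ a, |v (Sum.inl a)| + ∑ i ∈ S, |v (Sum.inr i)| =
      ∑ s ∈ (Finset.univ : Finset (Fin d)).disjSum S, |v s| := by rw [Finset.sum_disjSum]
  have h2 := Real.sum_mul_le_sqrt_mul_sqrt ((Finset.univ : Finset (Fin d)).disjSum S)
    (fun _ => (1 : ℝ)) fun s => |v s|
  simp only [one_mul, one_pow, sq_abs, Finset.sum_const, nsmul_eq_mul, mul_one,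
    Finset.card_disjSum, Finset.card_univ, Fintype.card_fin, Nat.cast_add] at h2
  rw [h1]
  refine h2.trans ?_
  rw [EuclideanSpace.norm_eq]
  refine mul_le_mul_of_nonneg_left (Real.sqrt_le_sqrt ?_) (Real.sqrt_nonneg _)
  simp only [Real.norm_eq_abs, sq_abs]
  exact Finset.sum_le_sum_of_subset_of_nonneg (Finset.subset_univ _) fun s _ _ => sq_nonneg _

/-- The basic inequality and the cone condition for a direction along which the penalized negative
log-likelihood does not increase. -/
theorem penNegLogLik_basic_inequality {f : Param d n → ℝ} {θ v : Param d n} {lam ν q : ℝ}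
    (hν : 0 < ν) (hlam : 2 * ν ≤ lam) (hq : 0 ≤ q) {S : Finset (Fin n)}
    (hS : ∀ i ∉ S, θ (Sum.inr i) = 0)
    (hgrad : ∀ s, |gradient f θ s| ≤ ν)
    (hconv : f θ + fderiv ℝ f θ v + q ≤ f (θ + v))
    (hle : f (θ + v) + lam * ∑ i, |(θ + v) (Sum.inr i)| ≤ f θ + lam * ∑ i, |θ (Sum.inr i)|) :
    q ≤ (lam + ν) * (Real.sqrt ((d : ℝ) + S.card) * ‖v‖) ∧
      ∑ i, |v (Sum.inr i)| ≤ 4 * (Real.sqrt ((d : ℝ) + S.card) * ‖v‖) := by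
  have h1 := fderiv_ge_of_abs_gradient_le hgrad v
  have h2 := sum_abs_add_sum_abs_le v S
  have h3 : ∑ i ∈ Sᶜ, |v (Sum.inr i)| - ∑ i ∈ S, |v (Sum.inr i)| ≤
      ∑ i, |(θ + v) (Sum.inr i)| - ∑ i, |θ (Sum.inr i)| := by
    rw [← Finset.sum_add_sum_compl S fun i => |(θ + v) (Sum.inr i)|,
      ← Finset.sum_add_sum_compl S fun i => |θ (Sum.inr i)|]
    have e1 : ∑ i ∈ Sᶜ, |θ (Sum.inr i)| = 0 := Finset.sum_eq_zero fun i hi => by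
      rw [hS i (Finset.mem_compl.1 hi), abs_zero]
    have e2 : ∑ i ∈ Sᶜ, |(θ + v) (Sum.inr i)| = ∑ i ∈ Sᶜ, |v (Sum.inr i)| :=
      Finset.sum_congr rfl fun i hi => by
        rw [PiLp.add_apply, hS i (Finset.mem_compl.1 hi), zero_add]
    have e3 : ∑ i ∈ S, |θ (Sum.inr i)| ≤
        ∑ i ∈ S, |(θ + v) (Sum.inr i)| + ∑ i ∈ S, |v (Sum.inr i)| := by
      rw [← Finset.sum_add_distrib]
      refine Finset.sum_le_sum fun i _ => ?_
      rw [PiLp.add_apply]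
      have := abs_sub (θ (Sum.inr i) + v (Sum.inr i)) (v (Sum.inr i))
      rwa [add_sub_cancel_right] at this
    linarith
  rw [← Finset.sum_add_sum_compl S fun i => |v (Sum.inr i)|] at h1 ⊢
  have hA : 0 ≤ ∑ a, |v (Sum.inl a)| := Finset.sum_nonneg fun _ _ => abs_nonneg _
  have hB : 0 ≤ ∑ i ∈ S, |v (Sum.inr i)| := Finset.sum_nonneg fun _ _ => abs_nonneg _
  have hC : 0 ≤ ∑ i ∈ Sᶜ, |v (Sum.inr i)| := Finset.sum_nonneg fun _ _ => abs_nonneg _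
  set A := ∑ a, |v (Sum.inl a)|
  set B := ∑ i ∈ S, |v (Sum.inr i)|
  set D := ∑ i ∈ Sᶜ, |v (Sum.inr i)|
  have h4 := mul_le_mul_of_nonneg_left h3 (by linarith : 0 ≤ lam)
  -- As `2ν ≤ λ`, one has `ν ≤ λ - ν` and `λ + ν ≤ 3(λ - ν)`. Hence `D ≤ A + 3B`, and `B + D ≤ 4(A +
  -- B)`.
  have h5 : q + (lam - ν) * D ≤ ν * A + (lam + ν) * B := by linarith
  constructor
  · have h6 := mul_le_mul_of_nonneg_left h2 (by linarith : 0 ≤ lam + ν)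
    have h7 : 0 ≤ (lam - ν) * D := mul_nonneg (by linarith) hC
    have h8 : 0 ≤ lam * A := mul_nonneg (by linarith) hA
    linarith
  · have h6 : (lam - ν) * D ≤ (lam - ν) * (A + 3 * B) := by nlinarith
    have h7 := le_of_mul_le_mul_left h6 (by linarith)
    linarith

/-- Convexity on the whole feasible set, not only near `θ*`, is what allows a distant minimizer to
be pulled back to the ball where the curvature is controlled. -/
theorem convexOn_penNegLogLik (F : ExpFamily) (X : Fin n → EuclideanSpace ℝ (Fin d))
    (y : Fin n → ℝ) {lam : ℝ} (hlam : 0 ≤ lam) :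
    ConvexOn ℝ (feasible F X) (penNegLogLik F.ψ X y lam) := by
  have hset : feasible F X = ⋂ i, (linPredCLM X i).toLinearMap ⁻¹' F.Θ := by
    ext θ
    simp [feasible, linPredCLM_apply]
  have hfeas : Convex ℝ (feasible F X) := by
    rw [hset]
    exact convex_iInter fun i => F.convexOn_ψ.1.linear_preimage _
  refine ⟨hfeas, fun θ hθ u hu a b ha hb hab => ?_⟩
  have h1 : ∀ i, F.ψ (linPred X (a • θ + b • u) i) ≤
      a * F.ψ (linPred X θ i) + b * F.ψ (linPred X u i) := fun i => by
    rw [linPred_add, linPred_smul, linPred_smul]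
    exact F.convexOn_ψ.2 (hθ i) (hu i) ha hb hab
  have h2 := Finset.sum_le_sum fun i (_ : i ∈ Finset.univ) => h1 i
  rw [Finset.sum_add_distrib, ← Finset.mul_sum, ← Finset.mul_sum] at h2
  have h3 : ∑ i, linPred X (a • θ + b • u) i * y i =
      a * ∑ i, linPred X θ i * y i + b * ∑ i, linPred X u i * y i := by
    simp only [linPred_add, linPred_smul, add_mul, Finset.sum_add_distrib, Finset.mul_sum,
      mul_assoc]
  have h4 : ∑ i, |(a • θ + b • u) (Sum.inr i)| ≤
      a * ∑ i, |θ (Sum.inr i)| + b * ∑ i, |u (Sum.inr i)| := by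
    rw [Finset.mul_sum, Finset.mul_sum, ← Finset.sum_add_distrib]
    refine Finset.sum_le_sum fun i _ => (abs_add_le _ _).trans (le_of_eq ?_)
    simp [abs_mul, abs_of_nonneg ha, abs_of_nonneg hb]
  have h5 := mul_le_mul_of_nonneg_left h2 (by positivity : 0 ≤ 1 / (n : ℝ))
  have h6 := mul_le_mul_of_nonneg_left h4 hlam
  simp only [penNegLogLik, negLogLik, h3, smul_eq_mul]
  linarith

/-- Restricted strong convexity of the augmented design. -/
theorem restricted_strong_convexity {X : Fin n → EuclideanSpace ℝ (Fin d)} (hn : 0 < n) {s : ℕ}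
    (hs : 0 < s) {σ : ℝ} (hσ : 0 < σ) (hσ4 : σ ≤ 4)
    (hlow : ∀ w, σ / 4 * n * ‖w‖ ^ 2 ≤ ∑ i, inner ℝ (X i) w ^ 2)
    (htop : ∀ T : Finset (Fin n), T.card ≤ s → ∀ w,
      ∑ i ∈ T, inner ℝ (X i) w ^ 2 ≤ (σ / 80) ^ 2 * n * ‖w‖ ^ 2)
    {v : Param d n} (hcone : ∑ i, |v (Sum.inr i)| ≤ 4 * (Real.sqrt s * ‖v‖)) :
    σ / 8 * ‖v‖ ^ 2 ≤ 1 / n * ∑ i, linPred X v i ^ 2 := by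
  have hnR : (0 : ℝ) < n := by exact_mod_cast hn
  have hsR : (0 : ℝ) < s := by exact_mod_cast hs
  set β : EuclideanSpace ℝ (Fin d) := WithLp.toLp 2 fun a => v (Sum.inl a) with hβ
  set ξ : Fin n → ℝ := fun i => v (Sum.inr i) with hξ
  have hnorm : ‖v‖ ^ 2 = ‖β‖ ^ 2 + ∑ i, ξ i ^ 2 := by
    rw [EuclideanSpace.real_norm_sq_eq, EuclideanSpace.real_norm_sq_eq, Fintype.sum_sum_type]
  have hξ0 : 0 ≤ ∑ i, ξ i ^ 2 := Finset.sum_nonneg fun i _ => sq_nonneg _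
  have hβv : ‖β‖ ≤ ‖v‖ := abs_le_of_sq_le_sq' (by linarith) (norm_nonneg v) |>.2
  have hξv : Real.sqrt (∑ i, ξ i ^ 2) ≤ ‖v‖ :=
    Real.sqrt_le_iff.2 ⟨norm_nonneg v, by nlinarith [sq_nonneg ‖β‖]⟩
  have hlin : ∀ i, linPred X v i = inner ℝ (X i) β + Real.sqrt n * ξ i := fun i => by
    simp [linPred, hβ, hξ, PiLp.inner_apply, mul_comm]
  -- With the cone condition the cross sum is at most `g‖v‖ + 4g‖v‖ = 5g‖v‖`. After multiplication
  -- by `2√n` this is at most `σ/8 · n‖v‖²`, half of the diagonal part.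
  set g := σ / 80 * Real.sqrt n * ‖β‖ with hg
  have hg0 : 0 ≤ g := by positivity
  have hcross := abs_sum_mul_le_of_partial_sums (a := fun i => inner ℝ (X i) β) (ξ := ξ) hs hg0
    fun T hT => (htop T hT β).trans (le_of_eq (by
      rw [hg, mul_pow, mul_pow, Real.sq_sqrt hnR.le]))
  have hcross' : |∑ i, inner ℝ (X i) β * ξ i| ≤ σ / 16 * Real.sqrt n * ‖v‖ ^ 2 := by
    refine hcross.trans ?_
    have h1 : g / Real.sqrt s * ∑ i, |ξ i| ≤ g / Real.sqrt s * (4 * (Real.sqrt s * ‖v‖)) := by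
      gcongr
    have h2 : g / Real.sqrt s * (4 * (Real.sqrt s * ‖v‖)) = 4 * g * ‖v‖ := by
      have : Real.sqrt s ≠ 0 := (Real.sqrt_pos.2 hsR).ne'
      field_simp
    have h3 : g * Real.sqrt (∑ i, ξ i ^ 2) ≤ g * ‖v‖ := by gcongr
    have h4 : g ≤ σ / 80 * Real.sqrt n * ‖v‖ := by rw [hg]; gcongr
    have h5 := mul_le_mul_of_nonneg_right h4 (norm_nonneg v)
    linarith
  have hexp : ∑ i, linPred X v i ^ 2 = ∑ i, inner ℝ (X i) β ^ 2 +
      2 * Real.sqrt n * ∑ i, inner ℝ (X i) β * ξ i + n * ∑ i, ξ i ^ 2 := by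
    rw [Finset.mul_sum, Finset.mul_sum, ← Finset.sum_add_distrib, ← Finset.sum_add_distrib]
    refine Finset.sum_congr rfl fun i _ => ?_
    rw [hlin, add_sq, mul_pow, Real.sq_sqrt hnR.le]
    ring
  have h1 := hlow β
  have h2 := mul_le_mul_of_nonneg_left (neg_le_of_abs_le hcross')
    (by positivity : 0 ≤ 2 * Real.sqrt n)
  have h3 : 2 * Real.sqrt n * -(σ / 16 * Real.sqrt n * ‖v‖ ^ 2) = -(σ / 8 * n * ‖v‖ ^ 2) := by
    calc _ = -(σ / 8 * (Real.sqrt n) ^ 2 * ‖v‖ ^ 2) := by ring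
      _ = _ := by rw [Real.sq_sqrt hnR.le]
  -- This is where `σ ≤ 4` matters: the `ξ`-block has curvature exactly `1`.
  have h4 : σ / 4 * n * ∑ i, ξ i ^ 2 ≤ n * ∑ i, ξ i ^ 2 := by
    have : σ / 4 * (n * ∑ i, ξ i ^ 2) ≤ 1 * (n * ∑ i, ξ i ^ 2) := by
      gcongr
      linarith
    linarith
  rw [one_div, le_inv_mul_iff₀ hnR, hexp]
  have h5 : σ / 4 * n * ‖v‖ ^ 2 = σ / 4 * n * ‖β‖ ^ 2 + σ / 4 * n * ∑ i, ξ i ^ 2 := by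
    rw [hnorm]; ring
  linarith

/-- The deterministic part of the error bound. -/
theorem norm_sub_le_of_isPenMinimizer (F : ExpFamily) {X : Fin n → EuclideanSpace ℝ (Fin d)}
    (y : Fin n → ℝ) {θ θhat : Param d n} {R κ lam ν σ : ℝ} (hκ : 0 < κ) (hσ : 0 < σ) (hν : 0 < ν)
    (hlam : 2 * ν ≤ lam) {S : Finset (Fin n)} (hS : ∀ i ∉ S, θ (Sum.inr i) = 0) (hd : 0 < d)
    (hC2 : ∀ i, ∀ u : Param d n, ‖u‖ ≤ R → linPred X (θ + u) i ∈ interior F.Θ ∧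
      κ ≤ deriv (deriv F.ψ) (linPred X (θ + u) i))
    (hgrad : ∀ s, |gradient (negLogLik F.ψ X y) θ s| ≤ ν)
    (hR : 32 / (σ * κ) * (lam + ν) * Real.sqrt ((d : ℝ) + S.card) ≤ R)
    (hrsc : ∀ v : Param d n, ∑ i, |v (Sum.inr i)| ≤ 4 * (Real.sqrt ((d : ℝ) + S.card) * ‖v‖) →
      σ / 8 * ‖v‖ ^ 2 ≤ 1 / n * ∑ i, linPred X v i ^ 2)
    (hmin : IsPenMinimizer F X y lam θhat) :
    ‖θhat - θ‖ ≤ 32 / (σ * κ) * (lam + ν) * Real.sqrt ((d : ℝ) + S.card) := by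
  have hdR : (0 : ℝ) < d := by exact_mod_cast hd
  have hrpos : 0 < Real.sqrt ((d : ℝ) + S.card) := Real.sqrt_pos.2 (by positivity)
  set r := Real.sqrt ((d : ℝ) + S.card) with hr
  set δ := 32 / (σ * κ) * (lam + ν) * r with hδ
  have hδpos : 0 < δ := by
    have : 0 < lam + ν := by linarith
    positivity
  have hlam0 : 0 ≤ lam := by linarith
  by_contra! hlt
  set u := θhat - θ with hu
  have hu0 : 0 < ‖u‖ := hδpos.trans hlt
  -- Any factor strictly between `1/2` and `1` would do: below `1` to stay in the open ball of
  -- radius `R`, above `1/2` because the inequalities below force `‖t • u‖ ≤ δ/2`.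
  set t := 3 / 4 * δ / ‖u‖ with ht
  have ht0 : 0 ≤ t := by positivity
  have ht1 : t ≤ 1 := by rw [ht, div_le_one hu0]; linarith
  have hv : ‖t • u‖ = 3 / 4 * δ := by
    rw [norm_smul, Real.norm_eq_abs, abs_of_nonneg ht0, ht, div_mul_cancel₀ _ hu0.ne']
  have hθ : θ ∈ feasible F X := fun i => by
    have := (hC2 i 0 (by rw [norm_zero]; linarith)).1
    rw [add_zero] at this
    exact interior_subset this
  have hle : penNegLogLik F.ψ X y lam (θ + t • u) ≤ penNegLogLik F.ψ X y lam θ := by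
    have h1 := (convexOn_penNegLogLik F X y hlam0).2 hθ hmin.1 (sub_nonneg.2 ht1) ht0
      (sub_add_cancel 1 t)
    have h2 : (1 - t) • θ + t • θhat = θ + t • u := by rw [hu, smul_sub, sub_smul, one_smul]; abel
    rw [h2] at h1
    have h3 : penNegLogLik F.ψ X y lam θhat ≤ penNegLogLik F.ψ X y lam θ := hmin.2 hθ
    simp only [smul_eq_mul] at h1
    have h4 := mul_le_mul_of_nonneg_left h3 ht0
    linarith
  have hcurv := negLogLik_add_fderiv_add_le F X y hκ hC2 (v := t • u) (by linarith)
  obtain ⟨hq, hcone⟩ := penNegLogLik_basic_inequality hν hlam (by positivity) hS hgrad hcurv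
    hle
  have h1 := mul_le_mul_of_nonneg_left (hrsc _ hcone) (by positivity : 0 ≤ κ / 2)
  have h2 := h1.trans hq
  rw [← hr, hv] at h2
  have h3 : (lam + ν) * r = σ * κ / 32 * δ := by rw [hδ]; field_simp
  have h4 : (lam + ν) * (r * (3 / 4 * δ)) = 3 / 4 * (σ * κ / 32) * δ ^ 2 := by
    calc _ = (lam + ν) * r * (3 / 4 * δ) := by ring
      _ = _ := by rw [h3]; ring
  rw [h4] at h2
  have h5 : 0 < σ * κ * δ ^ 2 := by positivity
  linarith

end Deterministic

/-! ### Whitening by the second moment matrix -/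

section Whitening

open scoped MatrixOrder Matrix.Norms.L2Operator

variable {d : ℕ}

theorem inner_toEuclideanLin {S : Matrix (Fin d) (Fin d) ℝ} (hS : S.IsHermitian)
    (v w : EuclideanSpace ℝ (Fin d)) :
    inner ℝ (S.toEuclideanLin v) w = inner ℝ v (S.toEuclideanLin w) :=
  Matrix.isSymmetric_toEuclideanLin_iff.2 hS v w

theorem toEuclideanLin_mul_apply (A B : Matrix (Fin d) (Fin d) ℝ) (v : EuclideanSpace ℝ (Fin d)) :
    (A * B).toEuclideanLin v = A.toEuclideanLin (B.toEuclideanLin v) := by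
  simp [Matrix.toLpLin_apply, Matrix.mulVec_mulVec]

theorem toEuclideanLin_one_apply (v : EuclideanSpace ℝ (Fin d)) :
    (1 : Matrix (Fin d) (Fin d) ℝ).toEuclideanLin v = v := by
  simp

/-- `invSqrt S` is the inverse of a symmetric square root of the positive definite matrix `S`. -/
theorem exists_mul_invSqrt_eq_one {S : Matrix (Fin d) (Fin d) ℝ} (hS : S.PosDef) :
    (invSqrt S).IsHermitian ∧ ∃ Q : Matrix (Fin d) (Fin d) ℝ,
      Q.IsHermitian ∧ Q * invSqrt S = 1 ∧ Q * Q = S := by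
  have hsq : CFC.sqrt S * CFC.sqrt S = S := CFC.sqrt_mul_sqrt_self S hS.posSemidef.nonneg
  have hH : (CFC.sqrt S).IsHermitian :=
    (Matrix.nonneg_iff_posSemidef.1 (CFC.sqrt_nonneg S)).isHermitian
  have hunit : IsUnit (CFC.sqrt S).det := by
    have h1 : IsUnit S.det := (Matrix.isUnit_iff_isUnit_det S).1 hS.isUnit
    rw [← hsq, Matrix.det_mul] at h1
    exact isUnit_of_mul_isUnit_left h1
  exact ⟨hH.inv, CFC.sqrt S, hH, Matrix.mul_nonsing_inv _ hunit, hsq⟩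

theorem inner_toEuclideanLin_self_sub_smul_one (S : Matrix (Fin d) (Fin d) ℝ) (t : ℝ)
    (w : EuclideanSpace ℝ (Fin d)) :
    inner ℝ w ((S - t • (1 : Matrix (Fin d) (Fin d) ℝ)).toEuclideanLin w) =
      inner ℝ w (S.toEuclideanLin w) - t * ‖w‖ ^ 2 := by
  rw [map_sub, map_smul, LinearMap.sub_apply, LinearMap.smul_apply, toEuclideanLin_one_apply,
    inner_sub_right, inner_smul_right, real_inner_self_eq_norm_sq]

/-- Boundedness makes every product of two coordinates integrable, so the expanded square can be
integrated term by term. -/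
theorem integral_inner_sq_eq (ρ : Measure (EuclideanSpace ℝ (Fin d))) [IsFiniteMeasure ρ]
    (hbdd : ∃ r : ℝ, 0 < r ∧ ∀ᵐ x ∂ρ, ‖x‖ ≤ r) (w : EuclideanSpace ℝ (Fin d)) :
    ∫ x, inner ℝ w x ^ 2 ∂ρ = inner ℝ w ((secondMoment ρ).toEuclideanLin w) := by
  obtain ⟨r, hr0, hr⟩ := hbdd
  have hint : ∀ a b : Fin d, Integrable (fun x : EuclideanSpace ℝ (Fin d) => x a * x b) ρ := by
    intro a b
    refine Integrable.of_bound (by fun_prop) (r * r) (hr.mono fun x hx => ?_)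
    rw [norm_mul]
    have h1 := (PiLp.norm_apply_le x a).trans hx
    have h2 := (PiLp.norm_apply_le x b).trans hx
    gcongr
  have hexp : ∀ x : EuclideanSpace ℝ (Fin d),
      inner ℝ w x ^ 2 = ∑ a, ∑ b, w a * w b * (x a * x b) := fun x => by
    rw [PiLp.inner_apply, sq, Finset.sum_mul_sum]
    refine Finset.sum_congr rfl fun a _ => Finset.sum_congr rfl fun b _ => ?_
    simp
    ring
  simp_rw [hexp]
  rw [integral_finsetSum _ fun a _ => integrable_finsetSum _ fun b _ => (hint a b).const_mul _,
    PiLp.inner_apply]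
  refine Finset.sum_congr rfl fun a _ => ?_
  rw [integral_finsetSum _ fun b _ => (hint a b).const_mul _]
  simp only [integral_const_mul, Matrix.toLpLin_apply, Matrix.mulVec, dotProduct,
    secondMoment, Matrix.of_apply, RCLike.inner_apply, conj_trivial, Finset.sum_mul]
  exact Finset.sum_congr rfl fun b _ => by ring

end Whitening

/-- For `L` strictly above the norm, some admissible `t < L` exists, so attainment of the infimum is
not needed. -/
theorem lintegral_exp_sq_le_two_of_subGaussianNorm_le {E : Type*} [MeasurableSpace E]
    {μ : Measure E} {Z : E → ℝ} {K L : ℝ} (hK : 0 < K) (hKL : K < L)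
    (h : subGaussianNorm μ Z ≤ ENNReal.ofReal K) :
    ∫⁻ x, ENNReal.ofReal (Real.exp (Z x ^ 2 / L ^ 2)) ∂μ ≤ 2 := by
  have h1 : subGaussianNorm μ Z < ENNReal.ofReal L :=
    h.trans_lt ((ENNReal.ofReal_lt_ofReal_iff (hK.trans hKL)).2 hKL)
  simp only [subGaussianNorm, iInf_lt_iff] at h1
  obtain ⟨t, ht, hexp, htL⟩ := h1
  refine (lintegral_mono fun x => ENNReal.ofReal_le_ofReal (Real.exp_le_exp.2 ?_)).trans hexp
  have h2 : (t : ℝ) ≤ L := by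
    rw [← ENNReal.ofReal_coe_nnreal, ENNReal.ofReal_lt_ofReal_iff (hK.trans hKL)] at htL
    exact htL.le
  have h3 : (0 : ℝ) < t := by exact_mod_cast ht
  gcongr

/-- The failure set may be non-measurable; its measurable hull has the same measure. -/
theorem HoldsWithProb.of_measure_not_le {Ω : Type*} [MeasurableSpace Ω] {P : Measure Ω}
    [IsProbabilityMeasure P] {Q : Ω → Prop} {δ : ℝ} (hδ : 0 ≤ δ)
    (h : P {ω | ¬ Q ω} ≤ ENNReal.ofReal δ) : HoldsWithProb P (1 - δ) Q := by
  refine ⟨(toMeasurable P {ω | ¬ Q ω})ᶜ, (measurableSet_toMeasurable _ _).compl, ?_, fun ω hω => ?_⟩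
  · rw [probReal_compl_eq_one_sub (measurableSet_toMeasurable _ _), measureReal_def,
      measure_toMeasurable]
    have := ENNReal.toReal_mono ENNReal.ofReal_ne_top h
    rw [ENNReal.toReal_ofReal hδ] at this
    linarith
  · by_contra hQ
    exact hω (subset_toMeasurable P _ hQ)

theorem HoldsWithProb.and {Ω : Type*} [MeasurableSpace Ω] {P : Measure Ω}
    [IsProbabilityMeasure P] {Q₁ Q₂ : Ω → Prop} {p q : ℝ} (h₁ : HoldsWithProb P p Q₁)
    (h₂ : HoldsWithProb P (1 - q) Q₂) : HoldsWithProb P (p - q) fun ω => Q₁ ω ∧ Q₂ ω := by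
  obtain ⟨A, hA, hPA, hA'⟩ := h₁
  obtain ⟨B, hB, hPB, hB'⟩ := h₂
  refine ⟨A ∩ B, hA.inter hB, ?_, fun ω hω => ⟨hA' ω hω.1, hB' ω hω.2⟩⟩
  have h1 := measureReal_union_add_inter (μ := P) (s := A) hB
  have h2 : P.real (A ∪ B) ≤ 1 := measureReal_le_one
  linarith

/-! ### The random design -/

section Random

variable {Ω : Type*} [MeasurableSpace Ω] {P : Measure Ω} [IsProbabilityMeasure P] {d n : ℕ}

/-- Uniform bounds for the empirical second moments of the rows and for the partial sums over few
rows. -/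
theorem AssumptionA.holdsWithProb {X : Fin n → Ω → EuclideanSpace ℝ (Fin d)}
    {ρ : Measure (EuclideanSpace ℝ (Fin d))} {K L σmin σmax : ℝ} (hA : AssumptionA P X ρ K σmin σmax)
    (hX : ∀ i, Measurable (X i)) (hn : 0 < n) (hσ : 0 < σmin) (hK : 0 < K) (hKL : K < L)
    (hL : 1 ≤ L) {s : ℝ} (hs : 0 < s) (hsn : s ≤ n)
    (hdim : d * Real.log (1 + 40 * L) ≤ n / (32 * L ^ 4))
    (hlog : Real.log (2 * n) ≤ n / (32 * L ^ 4)) :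
    HoldsWithProb P (1 - 2 / n) fun ω =>
      (∀ w, σmin / 4 * n * ‖w‖ ^ 2 ≤ ∑ i, inner ℝ (X i ω) w ^ 2) ∧
      ∀ T : Finset (Fin n), (T.card : ℝ) ≤ s → ∀ w,
        ∑ i ∈ T, inner ℝ (X i ω) w ^ 2 ≤ 4 * L ^ 2 * (s * Real.log (n / s) +
          (2 * s + d * Real.log (1 + 40 * L) + Real.log n)) * (σmax * ‖w‖ ^ 2) := by
  have hnR : (0 : ℝ) < n := by exact_mod_cast hn
  have hρ : IsProbabilityMeasure ρ := by
    rw [← hA.law ⟨0, hn⟩]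
    exact Measure.isProbabilityMeasure_map (hX _).aemeasurable
  set S := secondMoment ρ with hS
  have hlower : ∀ w, σmin * ‖w‖ ^ 2 ≤ inner ℝ w (S.toEuclideanLin w) := fun w => by
    have h1 := (Matrix.isPositive_toEuclideanLin_iff.2 hA.lower).inner_nonneg_right w
    rw [inner_toEuclideanLin_self_sub_smul_one] at h1
    linarith
  have hupper : ∀ w, inner ℝ w (S.toEuclideanLin w) ≤ σmax * ‖w‖ ^ 2 := fun w => by
    have h1 := (Matrix.isPositive_toEuclideanLin_iff.2 hA.upper).inner_nonneg_right w
    rw [← neg_sub S, map_neg, LinearMap.neg_apply, inner_neg_right,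
      inner_toEuclideanLin_self_sub_smul_one] at h1
    linarith
  have hpd : S.PosDef := by
    have h1 : (σmin • (1 : Matrix (Fin d) (Fin d) ℝ)).PosDef := Matrix.PosDef.one.smul hσ
    simpa using h1.add_posSemidef hA.lower
  obtain ⟨hAH, Q, hBH, hBA, hBB⟩ := exists_mul_invSqrt_eq_one hpd
  set A := (invSqrt S).toEuclideanLin with hAdef
  set B := Q.toEuclideanLin with hBdef
  -- With `A = Σ^(-1/2)` and `B = Σ^(1/2)`, testing a row against `w` is testing the isotropic
  -- vector `A x` against `B w`; the price is `‖B w‖² = ⟨w, Σ w⟩`, which lies between `σmin ‖w‖²`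
  -- and `σmax ‖w‖²`.
  have hinner : ∀ x w, inner ℝ (B w) (A x) = inner ℝ x w := fun x w => by
    rw [hAdef, hBdef, inner_toEuclideanLin hBH, ← toEuclideanLin_mul_apply, hBA,
      toEuclideanLin_one_apply, real_inner_comm]
  have hBnorm : ∀ w, ‖B w‖ ^ 2 = inner ℝ w (S.toEuclideanLin w) := fun w => by
    rw [← real_inner_self_eq_norm_sq, hBdef, inner_toEuclideanLin hBH, ← toEuclideanLin_mul_apply,
      hBB]
  have hAmeas : Measurable A := A.continuous_of_finiteDimensional.measurable
  have hvar : ∀ v, ‖v‖ = 1 → ∫ x, inner ℝ v (A x) ^ 2 ∂ρ = 1 := fun v hv => by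
    simp_rw [hAdef, ← inner_toEuclideanLin hAH]
    rw [integral_inner_sq_eq ρ hA.bounded, ← hS, ← hBnorm, hBdef, ← toEuclideanLin_mul_apply, hBA,
      toEuclideanLin_one_apply, hv, one_pow]
  have hprob := measure_not_quadraticForm_bounds_le hn (Z := fun i ω => A (X i ω))
    (hA.indep.comp (fun _ => A) fun _ => hAmeas) (fun i => hAmeas.comp (hX i)) hL
    (fun i v hv => by
      rw [← lintegral_map (μ := P) (g := X i)
        (f := fun x => ENNReal.ofReal (Real.exp (inner ℝ v (A x) ^ 2 / L ^ 2))) (by fun_prop) (hX i),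
        hA.law i]
      exact lintegral_exp_sq_le_two_of_subGaussianNorm_le hK hKL (hA.subGaussian v hv))
    (fun i v hv => by
      rw [← integral_map (μ := P) (φ := X i) (f := fun x => inner ℝ v (A x) ^ 2)
        (hX i).aemeasurable (by fun_prop), hA.law i]
      exact hvar v hv)
    hs hsn (by simpa using hdim) hlog
  obtain ⟨G, hG, hGP, hG'⟩ := HoldsWithProb.of_measure_not_le (by positivity) hprob
  refine ⟨G, hG, hGP, fun ω hω => ?_⟩
  obtain ⟨h1, h2⟩ := hG' ω hω
  constructor
  · intro w
    have h3 := h1 (B w)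
    simp only [hinner] at h3
    refine le_trans ?_ h3
    rw [hBnorm]
    have := mul_le_mul_of_nonneg_left (hlower w) (by positivity : 0 ≤ (n : ℝ) / 4)
    linarith
  · intro T hT w
    have h3 := h2 T hT (B w)
    simp only [hinner, finrank_euclideanSpace, Fintype.card_fin] at h3
    refine h3.trans (mul_le_mul_of_nonneg_left ((hBnorm w).trans_le (hupper w)) ?_)
    have e1 : 0 ≤ Real.log (n / s) := Real.log_nonneg ((one_le_div hs).2 hsn)
    have e2 : 0 ≤ Real.log (1 + 40 * L) := Real.log_nonneg (by linarith)
    have e3 : 0 ≤ Real.log n := Real.log_natCast_nonneg n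
    positivity

end Random

/-- The two semidefinite matrices add up to `(σmax - σmin) I`, whose diagonal is non-empty as `d >
0`. -/
theorem AssumptionA.le {Ω : Type*} [MeasurableSpace Ω] {P : Measure Ω} {d n : ℕ} (hd : 0 < d)
    {X : Fin n → Ω → EuclideanSpace ℝ (Fin d)} {ρ : Measure (EuclideanSpace ℝ (Fin d))}
    {K σmin σmax : ℝ} (hA : AssumptionA P X ρ K σmin σmax) : σmin ≤ σmax := by
  have h := (hA.upper.add hA.lower).diag_nonneg (i := ⟨0, hd⟩)
  rw [sub_add_sub_cancel] at h
  simpa using h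

/-! ### Sample size -/

/-- The constant of the sample size condition, for rows with sub-Gaussian norm less than `L` and a
proportion `c` of the sample size that bounds the number of parameters. -/
noncomputable def sampleSizeConst (L c : ℝ) : ℝ :=
  25600 * L ^ 2 * (2 + (2 + Real.log (1 + 40 * L)) / Real.log (1 / c)) +
    128 * L ^ 4 * (Real.log (1 + 40 * L) / Real.log (1 / c)) + 256 * L ^ 4

/-- Consequences of the sample size condition. -/
theorem sampleSize_consequences {L c : ℝ} (hL : 1 ≤ L) (hc : c ∈ Set.Ioo (0 : ℝ) 1) {d n : ℕ}
    {s σmin σmax q : ℝ} (hn : 2 ≤ n) (hds : d ≤ s) (hs : 0 < s) (hsc : s ≤ c * n) (hσ : 0 < σmin)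
    (hσ4 : σmin ≤ 4) (hσle : σmin ≤ σmax) (hq : 1 ≤ q)
    (h : sampleSizeConst L c / σmin * (σmax / σmin) * q ^ 2 *
      max (s * Real.log (n / s)) (Real.log n) ≤ n) :
    d * Real.log (1 + 40 * L) ≤ n / (32 * L ^ 4) ∧ Real.log (2 * n) ≤ n / (32 * L ^ 4) ∧
      4 * L ^ 2 * (s * Real.log (n / s) + (2 * s + d * Real.log (1 + 40 * L) + Real.log n)) * σmax ≤
        (σmin / 80) ^ 2 * n := by
  obtain ⟨hc0, hc1⟩ := hc
  have hnR : (2 : ℝ) ≤ n := by exact_mod_cast hn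
  have hL0 : 0 < L := by linarith
  unfold sampleSizeConst at h
  set D := Real.log (1 + 40 * L) with hD
  have hD0 : 0 ≤ D := Real.log_nonneg (by linarith)
  set g := Real.log (1 / c) with hg
  have hg0 : 0 < g := Real.log_pos ((one_lt_div hc0).2 hc1)
  set m := max (s * Real.log (n / s)) (Real.log n) with hm
  have hm1 : s * Real.log (n / s) ≤ m := le_max_left _ _
  have hm2 : Real.log n ≤ m := le_max_right _ _
  have hlog0 : 0 ≤ Real.log n := Real.log_natCast_nonneg n
  have hm0 : 0 ≤ m := hlog0.trans hm2
  -- `s ≤ c n` gives `log (n/s) ≥ log (1/c) = g > 0`, so terms linear in `s` or `d` are absorbed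
  -- into `m`.
  have hsm : s ≤ m / g := by
    rw [le_div_iff₀ hg0]
    refine le_trans (mul_le_mul_of_nonneg_left (Real.log_le_log (by positivity) ?_) hs.le) hm1
    rw [div_le_div_iff₀ hc0 hs]
    linarith
  have hdm : d * D ≤ D / g * m := by
    calc d * D ≤ m / g * D := by gcongr; exact hds.trans hsm
      _ = _ := by ring
  set H := 2 + (2 + D) / g with hH
  have hH0 : 0 < H := by positivity
  -- One constant per conclusion. `C₁` serves the partial sums, with `25600 = 4 · 80²`; `C₂ = 4 · 32
  -- L⁴ D/g` serves the dimension; `C₃ = 4 · 2 · 32 L⁴` serves `log (2n) ≤ 2 log n`. The factors `4`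
  -- in `C₂` and `C₃` come from `σmin ≤ 4`.
  set C₁ := 25600 * L ^ 2 * H with hC₁
  set C₂ := 128 * L ^ 4 * (D / g) with hC₂
  set C₃ := 256 * L ^ 4 with hC₃
  have hC₁0 : 0 < C₁ := by positivity
  have hC₂0 : 0 ≤ C₂ := by positivity
  have hC₃0 : 0 < C₃ := by positivity
  have hσ0 : 0 < σmax := hσ.trans_le hσle
  have hq2 : 1 ≤ q ^ 2 := one_le_pow₀ hq
  have hmain : (C₁ + C₂ + C₃) / σmin * (σmax / σmin) * m ≤ n := by
    refine le_trans ?_ h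
    exact mul_le_mul_of_nonneg_right (le_mul_of_one_le_right (by positivity) hq2) hm0
  have hquarter : (C₁ + C₂ + C₃) / 4 * m ≤ n := by
    refine le_trans ?_ hmain
    gcongr
    calc (C₁ + C₂ + C₃) / 4 ≤ (C₁ + C₂ + C₃) / σmin := by gcongr
      _ ≤ _ := le_mul_of_one_le_right (by positivity) ((one_le_div hσ).2 hσle)
  have p₁ : 0 ≤ C₁ * m := by positivity
  have p₂ : 0 ≤ C₂ * m := by positivity
  have p₃ : 0 ≤ C₃ * m := by positivity
  refine ⟨?_, ?_, ?_⟩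
  · refine hdm.trans ?_
    rw [le_div_iff₀ (by positivity)]
    calc D / g * m * (32 * L ^ 4) = C₂ / 4 * m := by rw [hC₂]; ring
      _ ≤ n := by linarith
  · have h2 : Real.log (2 * n) ≤ 2 * m := by
      rw [Real.log_mul two_ne_zero (by positivity)]
      have := Real.log_le_log two_pos hnR
      linarith
    refine h2.trans ?_
    rw [le_div_iff₀ (by positivity)]
    calc 2 * m * (32 * L ^ 4) = C₃ / 4 * m := by rw [hC₃]; ring
      _ ≤ n := by linarith
  · have h1 : s * Real.log (n / s) + (2 * s + d * D + Real.log n) ≤ H * m := by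
      have e : H * m = m + (2 * (m / g) + D / g * m + m) := by rw [hH]; ring
      rw [e]
      linarith
    have h2 : 4 * L ^ 2 * (s * Real.log (n / s) + (2 * s + d * D + Real.log n)) * σmax ≤
        4 * L ^ 2 * (H * m) * σmax := by gcongr
    refine h2.trans ?_
    have h3 : C₁ / σmin * (σmax / σmin) * m ≤ n := by
      refine le_trans ?_ hmain
      gcongr
      linarith
    have h4 := mul_le_mul_of_nonneg_left h3 (by positivity : 0 ≤ (σmin / 80) ^ 2)
    refine le_trans (le_of_eq ?_) h4
    rw [hC₁]
    field_simp
    ring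

/-! ### The error bound -/

theorem theorem1 (K c : ℝ) (hK : 0 < K) (hc : c ∈ Set.Ioo (0 : ℝ) 1) :
    ∃ C₀ : ℝ, 0 < C₀ ∧
      ∀ (F : ExpFamily) (Ω : Type*) [MeasurableSpace Ω] (P : Measure Ω) [IsProbabilityMeasure P]
        (d n N : ℕ) (M : LinkedGLM F P d n N) (ρ : Measure (EuclideanSpace ℝ (Fin d)))
        (σmin σmax ν ε ε' R lamR LamR C lam : ℝ),
        0 < d →
        0 < σmin → σmin ≤ 4 →
        AssumptionA P M.row ρ K σmin σmax →
        0 < ν → ConditionC1 M ν ε →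
        0 < R → 0 < lamR → lamR ≤ LamR → ConditionC2 M R lamR LamR σmin lam ν ε' →
        0 < C → 2 * ν ≤ lam → lam ≤ C * ν →
        (d : ℝ) + M.mismatches ≤ c * n →
        (C₀ / σmin) * (σmax / σmin) * (LamR / lamR) ^ 2 *
            max (((d : ℝ) + M.mismatches) * Real.log (n / ((d : ℝ) + M.mismatches)))
              (Real.log n) ≤ n →
        HoldsWithProb P (1 - ε - ε' - 2 / n) fun ω =>
          ∀ θhat : Param d n,
            IsPenMinimizer F (fun i => M.row i ω) (M.resp ω) lam θhat →
            ‖θhat - M.thetaStar ω‖ ≤ errorBound M σmin lamR lam ν := by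
 
  -- `L = 2K + 1` is both at least `1` and strictly larger than `K`.
  have hL1 : 1 ≤ 2 * K + 1 := by linarith
  have hL0 : 0 < 2 * K + 1 := by linarith
  refine ⟨sampleSizeConst (2 * K + 1) c, ?_, ?_⟩
  · have h1 : 0 ≤ Real.log (1 + 40 * (2 * K + 1)) := Real.log_nonneg (by linarith)
    have h2 : 0 < Real.log (1 / c) := Real.log_pos ((one_lt_div hc.1).2 hc.2)
    unfold sampleSizeConst
    positivity
  intro F Ω _ P _ d n N M ρ σmin σmax ν ε ε' R lamR LamR C lam hd hσ hσ4 hA hν hC1 _ hlamR hLamR hC2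
    _ hlam _ hsc hsize
  have hdR : (1 : ℝ) ≤ d := by exact_mod_cast hd
  have hkR : (0 : ℝ) ≤ M.mismatches := Nat.cast_nonneg _
  -- `1 ≤ d + k ≤ c n` with `c < 1` excludes `n ≤ 1`.
  have hn : 2 ≤ n := by
    by_contra! hlt
    have h1 : (n : ℝ) ≤ 1 := by exact_mod_cast Nat.lt_succ_iff.1 hlt
    have h2 : c * n ≤ c * 1 := mul_le_mul_of_nonneg_left h1 hc.1.le
    linarith [hc.2]
  have hn0 : 0 < n := by omega
  have hsn : (d : ℝ) + M.mismatches ≤ n :=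
    hsc.trans (mul_le_of_le_one_left (Nat.cast_nonneg n) hc.2.le)
  have hs0 : (0 : ℝ) < (d : ℝ) + M.mismatches := by linarith
  obtain ⟨hdim, hlog, htop⟩ := sampleSize_consequences hL1 hc hn (le_add_of_nonneg_right hkR) hs0 hsc
    hσ hσ4 (hA.le hd) ((one_le_div hlamR).2 hLamR) hsize
  have hdesign := hA.holdsWithProb (fun i => M.measurable_x _) hn0 hσ hK
    (by linarith : K < 2 * K + 1) hL1 hs0 hsn hdim hlog
  obtain ⟨G, hG, hGP, hG'⟩ := (hC1.and hC2).and hdesign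
  refine ⟨G, hG, hGP, fun ω hω θhat hmin => ?_⟩
  obtain ⟨⟨⟨-, hgrad⟩, hcurv, hR⟩, hlow, hpart⟩ := hG' ω hω
  set S := Finset.univ.filter fun i : Fin n => M.perm i ≠ Fin.castLE M.le i with hS
  refine norm_sub_le_of_isPenMinimizer F (M.resp ω) hlamR hσ hν hlam (S := S) (fun i hi => ?_) hd
    (fun i u hu => ⟨(hcurv i u hu).1, (hcurv i u hu).2.1⟩) hgrad hR (fun v hv => ?_) hmin
  -- A correctly matched record has `ξ*_i = 0`, so `ξ*` is supported on the mismatches.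
  · have h1 : M.perm i = Fin.castLE M.le i := by simpa [hS] using hi
    simp [LinkedGLM.thetaStar, LinkedGLM.row, h1]
  · refine restricted_strong_convexity hn0 (s := d + M.mismatches) (by omega) hσ hσ4 hlow
      (fun T hT w => ?_) (by push_cast; exact hv)
    refine (hpart T (by exact_mod_cast hT) w).trans ?_
    rw [← mul_assoc]
    exact mul_le_mul_of_nonneg_right htop (sq_nonneg _)
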